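/- **Setting.** Let $\mathcal H$ be a complex Hilbert space (in particular any finite-dimensional one), $\Gamma,K\ge 1$, $t\ge 0$, $\omega>0$. Let $H(\tau)=\sum_{\gamma=1}^{\Gamma}H_\gamma(\tau)$, where on $[0,t]$ each $H_\gamma$ agrees with a time-periodic Hamiltonian $\sum_{m\in\mathbb Z}H_{\gamma m}e^{-im\omega\tau}$ that has bounded operators $H_{\gamma m}$ with $\sum_m\|H_{\gamma m}\|<\infty$ as Fourier coefficients (for instance $\|H_{\gamma m}\|=O(|m|^{-p-2})$ with $p\ge 1$) and is self-adjoint for every $\tau\in\mathbb R$. Let $$U(t_1,t_0)=\mathcal T\exp\Big(-i\int_{t_0}^{t_1}H(s)\,ds\Big),\qquad U_\gamma(t_1,t_0)=\mathcal T\exp\Big(-i\int_{t_0}^{t_1}H_\gamma(s)\,ds\Big)$$ be the time-ordered exponentials. Products $\prod^{\leftarrow}$ are ordered with later factors on the left. **Product formula.** Let $\gamma_k\in\{1,\dots,\Gamma\}$, $\alpha_k\in[-1,1]$, $\beta_k\in[0,1]$ $(1\le k\le K)$ satisfy $\sum_{k:\gamma_k=\gamma}\alpha_k=1$ for all $\gamma$,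 $\beta_1=0$, $\beta_K+\alpha_K=1$ and $0\le\beta_k+\alpha_k\le1$, and put $$S(\tau,0)=\prod_{k=1,\dots,K}^{\leftarrow}U_{\gamma_k}(\beta_k\tau+\alpha_k\tau,\beta_k\tau),$$ where for $\alpha_k<0$ the factor means $U_{\gamma_k}(\beta_k\tau,\beta_k\tau-|\alpha_k|\tau)^\dagger$. **Floquet space.** On $\ell^2(\mathbb Z)\otimes\mathcal H$ let $H^{\mathrm{Add}}_\gamma=\sum_m\big(\sum_l|l+m\rangle\langle l|\big)\otimes H_{\gamma m}$, which is bounded, let $H_{\mathrm{LP}}=\sum_l l\omega|l\rangle\langle l|\otimes I$ be the self-adjoint multiplication operator on its maximal domain, and let $H^F_\gamma=H^{\mathrm{Add}}_\gamma-H_{\mathrm{LP}}$ on the domain of $H_{\mathrm{LP}}$. For self-adjoint $A$, $e^{-iAs}$ denotes its unitary group. Let $T^F_{\le\kappa}(\tau)$, $0\le\kappa\le 2K-1$, be the product (later factors on the left) of the first $\kappa$ of the factors whose $(2k-1)$-th is $e^{-iH^F_{\gamma_k}\alpha_k\tau}$ and whose $2k$-th is $e^{-iH_{\mathrm{LP}}(\beta_k+\alpha_k-\beta_{k+1})\tau}$.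 Put $T^F=T^F_{\le 2K-1}$, $T^F_{<\kappa}=T^F_{\le\kappa-1}$, and $$\Delta^F(\tau)=\sum_{\gamma=1}^{\Gamma}T^F(\tau)^\dagger H^{\mathrm{Add}}_\gamma T^F(\tau)-\sum_{k=1}^{K}(\beta_k+\alpha_k)\,T^F_{\le2k-1}(\tau)^\dagger H^{\mathrm{Add}}_{\gamma_k}T^F_{\le2k-1}(\tau)+\sum_{k=1}^{K}\beta_k\,T^F_{<2k-1}(\tau)^\dagger H^{\mathrm{Add}}_{\gamma_k}T^F_{<2k-1}(\tau).$$ For an operator $X$, $\langle l|X|0\rangle$ denotes its matrix element, an operator on $\mathcal H$. **Theorem.** For every $\tau\in[0,t]$ the series $\sum_{l\in\mathbb Z}\langle l|\Delta^F(\tau)|0\rangle$ converges absolutely in operator norm, the integrands below are integrable on $[0,t]$, and $$U(t,0)-S(t,0)=-i\int_0^t U(t,\tau)\,S(\tau,0)\Big(\sum_{l\in\mathbb Z}\langle l|\Delta^F(\tau)|0\rangle\Big)d\tau .$$ Consequently $$\|U(t,0)-S(t,0)\|\le\int_0^t\Big\|\sum_{l\in\mathbb Z}\langle l|\Delta^F(\tau)|0\rangle\Big\|\,d\tau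 .$$ -/

import Mathlib

open scoped ENNReal

namespace FloquetPF

noncomputable section

/-! ### Time evolution and Fourier series on the physical Hilbert space -/

section Physical

variable {𝓗 : Type*} [NormedAddCommGroup 𝓗] [InnerProductSpace ℂ 𝓗] [CompleteSpace 𝓗]

/-- The `n`-th term of the time-ordered exponential of `-i ∫_{t₀}^t H(s) ds`:
`D₀ = 1` and `D_{n+1}(t) = -i ∫_{t₀}^t H(s) D_n(s) ds`. -/
def dysonTerm (H : ℝ → 𝓗 →L[ℂ] 𝓗) (t₀ : ℝ) : ℕ → ℝ → (𝓗 →L[ℂ] 𝓗)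
  | 0, _ => 1
  | n + 1, t => -(Complex.I • ∫ s in t₀..t, H s * dysonTerm H t₀ n s)

/-- The time-evolution operator `U(t,t₀) = 𝒯 exp(-i ∫_{t₀}^t H(s) ds)`, as the sum of its
time-ordered (Dyson) series. -/
def timeEvol (H : ℝ → 𝓗 →L[ℂ] 𝓗) (t t₀ : ℝ) : 𝓗 →L[ℂ] 𝓗 :=
  ∑' n : ℕ, dysonTerm H t₀ n t

/-- The time-periodic operator `∑_m H_m e^{-imωτ}` with Fourier coefficients `H_m`. -/
def fourierHam (ω : ℝ) (h : ℤ → 𝓗 →L[ℂ] 𝓗) (τ : ℝ) : 𝓗 →L[ℂ] 𝓗 :=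
  ∑' m : ℤ, Complex.exp (-(Complex.I * m * ω * τ)) • h m

/-- The conditions on the data of a product formula with `K` factors. All sequences are indexed
by `k = 1, …, K`; their values at other indices play no role. -/
structure IsFormula {Γ : ℕ} (K : ℕ) (γ : ℕ → Fin Γ) (α β : ℕ → ℝ) : Prop where
  one_le : 1 ≤ K
  alpha_mem : ∀ k ∈ Finset.Icc 1 K, α k ∈ Set.Icc (-1 : ℝ) 1
  alpha_sum : ∀ j : Fin Γ, ∑ k ∈ (Finset.Icc 1 K).filter (fun k => γ k = j), α k = 1
  beta_one : β 1 = 0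
  beta_last : β K + α K = 1
  beta_mem : ∀ k ∈ Finset.Icc 1 K, β k ∈ Set.Icc (0 : ℝ) 1
  beta_add_alpha_mem : ∀ k ∈ Finset.Icc 1 K, β k + α k ∈ Set.Icc (0 : ℝ) 1

variable {Γ : ℕ}

/-- The factor `U_{γ_k}(β_k t + α_k t, β_k t)`, which for negative `α_k` means
`U_{γ_k}(β_k t, β_k t - |α_k| t)†`. -/
def formulaFactor (H : Fin Γ → ℝ → 𝓗 →L[ℂ] 𝓗) (γ : ℕ → Fin Γ) (α β : ℕ → ℝ) (t : ℝ) (k : ℕ) :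
    𝓗 →L[ℂ] 𝓗 :=
  if 0 ≤ α k then timeEvol (H (γ k)) (β k * t + α k * t) (β k * t)
  else ContinuousLinearMap.adjoint (timeEvol (H (γ k)) (β k * t) (β k * t - |α k| * t))

/-- The ordered product of the first `n` factors; later factors stand on the left. -/
def partialFormula (H : Fin Γ → ℝ → 𝓗 →L[ℂ] 𝓗) (γ : ℕ → Fin Γ) (α β : ℕ → ℝ) (t : ℝ) :
    ℕ → (𝓗 →L[ℂ] 𝓗)
  | 0 => 1
  | n + 1 => formulaFactor H γ α β t (n + 1) * partialFormula H γ α β t n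

/-- The time-dependent product formula `S(t,0)`. -/
def productFormula (H : Fin Γ → ℝ → 𝓗 →L[ℂ] 𝓗) (K : ℕ) (γ : ℕ → Fin Γ) (α β : ℕ → ℝ) (t : ℝ) :
    𝓗 →L[ℂ] 𝓗 :=
  partialFormula H γ α β t K

end Physical

/-! ### Unitary groups of unbounded self-adjoint operators -/

section UnitaryGroup

variable {E : Type*} [NormedAddCommGroup E] [InnerProductSpace ℂ E] [CompleteSpace E]

/-- `V` is the strongly continuous one-parameter unitary group `t ↦ e^{-iAt}`: a vector `x` lies in
the domain of `A` with `A x = y` exactly when `t ↦ V t x` has derivative `-i y` at `0`. -/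
structure IsUnitaryGroup (A : E →ₗ.[ℂ] E) (V : ℝ → E →L[ℂ] E) : Prop where
  mem_unitary : ∀ t, V t ∈ unitary (E →L[ℂ] E)
  map_zero : V 0 = 1
  map_add : ∀ s t, V (s + t) = V s * V t
  continuous : ∀ x, Continuous fun t => V t x
  generator : ∀ x y, (x, y) ∈ A.graph ↔ HasDerivAt (fun t => V t x) (-(Complex.I • y)) 0

open Classical in
/-- `e^{-iAt}` for a self-adjoint operator `A`, not necessarily bounded. The unitary group of `A` is
unique, and by Stone's theorem it exists exactly when `A` is self-adjoint. -/
def expNegI (A : E →ₗ.[ℂ] E) (t : ℝ) : E →L[ℂ] E :=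
  if hA : ∃ V : ℝ → E →L[ℂ] E, IsUnitaryGroup A V then hA.choose t else 0

end UnitaryGroup

/-! ### Operators on the Floquet-Hilbert space -/

section Floquet

variable {𝓗 : Type*} [NormedAddCommGroup 𝓗] [InnerProductSpace ℂ 𝓗]

/-- The Floquet-Hilbert space `ℓ²(ℤ) ⊗ 𝓗`, realised as `ℓ²(ℤ; 𝓗)`. The vector `|l⟩ ⊗ ψ` is
`lp.single 2 l ψ`. -/
abbrev FloquetSpace (𝓗 : Type*) [NormedAddCommGroup 𝓗] : Type _ := lp (fun _ : ℤ => 𝓗) 2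

theorem summable_addTensor (m : ℤ) (A : 𝓗 →L[ℂ] 𝓗) (ψ : FloquetSpace 𝓗) :
    Summable fun l : ℤ => (‖A‖ * ‖ψ (l - m)‖) ^ (2 : ℝ≥0∞).toReal := by
  have h : Summable fun l : ℤ => ‖ψ l‖ ^ (2 : ℝ≥0∞).toReal :=
    (lp.memℓp ψ).summable (by norm_num)
  have h' := ((Equiv.subRight m).summable_iff.mpr h).mul_left (‖A‖ ^ (2 : ℝ≥0∞).toReal)
  refine h'.congr fun l => ?_
  simp [mul_pow]

/-- The operator `Add_m ⊗ A = ∑_l |l+m⟩⟨l| ⊗ A`, i.e. `(ψ_l)_l ↦ (A ψ_{l-m})_l`. -/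
def addTensor (m : ℤ) (A : 𝓗 →L[ℂ] 𝓗) : FloquetSpace 𝓗 →L[ℂ] FloquetSpace 𝓗 :=
  LinearMap.mkContinuous
    { toFun := fun ψ => ⟨fun l => A (ψ (l - m)), memℓp_gen
        ((summable_addTensor m A ψ).of_nonneg_of_le (fun _ => by positivity) fun l => by
          gcongr; exact A.le_opNorm _)⟩
      map_add' := fun ψ φ => lp.ext (funext fun l => map_add A (ψ (l - m)) (φ (l - m)))
      map_smul' := fun c ψ => lp.ext (funext fun l => map_smul A c (ψ (l - m))) } ‖A‖ (fun ψ => by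
    refine lp.norm_le_of_tsum_le (by norm_num) (by positivity) ?_
    calc ∑' l : ℤ, ‖A (ψ (l - m))‖ ^ (2 : ℝ≥0∞).toReal
        ≤ ∑' l : ℤ, (‖A‖ * ‖ψ (l - m)‖) ^ (2 : ℝ≥0∞).toReal := by
          refine Summable.tsum_le_tsum (fun l => ?_)
            ((summable_addTensor m A ψ).of_nonneg_of_le (fun _ => by positivity) fun l => ?_)
            (summable_addTensor m A ψ)
          · gcongr; exact A.le_opNorm _
          · gcongr; exact A.le_opNorm _
      _ = ‖A‖ ^ (2 : ℝ≥0∞).toReal * ∑' l : ℤ, ‖ψ (l - m)‖ ^ (2 : ℝ≥0∞).toReal := by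
          rw [← tsum_mul_left]
          simp [mul_pow]
      _ = (‖A‖ * ‖ψ‖) ^ (2 : ℝ≥0∞).toReal := by
          have h1 := (Equiv.subRight m).tsum_eq (fun l : ℤ => ‖ψ l‖ ^ (2 : ℝ≥0∞).toReal)
          have h2 := lp.norm_rpow_eq_tsum (p := 2) (by norm_num) ψ
          rw [Real.mul_rpow (norm_nonneg A) (norm_nonneg ψ), h2, ← h1]
          rfl
      _ ≤ _ := le_rfl)

/-- `H^Add = ∑_m Add_m ⊗ H_m`, a norm-convergent series if `∑_m ‖H_m‖ < ∞`. -/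
def addHam (h : ℤ → 𝓗 →L[ℂ] 𝓗) : FloquetSpace 𝓗 →L[ℂ] FloquetSpace 𝓗 :=
  ∑' m : ℤ, addTensor m (h m)

/-- The linear potential `H_LP = ∑_l l ω |l⟩⟨l| ⊗ I`, an unbounded operator on its maximal
domain. -/
def linPot (𝓗 : Type*) [NormedAddCommGroup 𝓗] [InnerProductSpace ℂ 𝓗] (ω : ℝ) :
    FloquetSpace 𝓗 →ₗ.[ℂ] FloquetSpace 𝓗 where
  domain :=
    { carrier := {ψ | Memℓp (fun l : ℤ => ((l : ℂ) * (ω : ℂ)) • ψ l) 2}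
      add_mem' := fun {ψ φ} hψ hφ => by simpa [smul_add, Pi.add_def] using hψ.add hφ
      zero_mem' := by simpa using (zero_mem_ℓp' : Memℓp (fun _ : ℤ => (0 : 𝓗)) 2)
      smul_mem' := fun c ψ hψ => by
        simpa [Pi.smul_def, smul_comm c] using Memℓp.const_smul hψ c }
  toFun :=
    { toFun := fun ψ => ⟨fun l : ℤ => ((l : ℂ) * (ω : ℂ)) • (ψ : FloquetSpace 𝓗) l, ψ.2⟩
      map_add' := fun ψ φ => lp.ext (funext fun l =>
        smul_add ((l : ℂ) * (ω : ℂ)) ((ψ : FloquetSpace 𝓗) l) ((φ : FloquetSpace 𝓗) l))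
      map_smul' := fun c ψ => lp.ext (funext fun l =>
        smul_comm ((l : ℂ) * (ω : ℂ)) c ((ψ : FloquetSpace 𝓗) l)) }

/-- The Floquet Hamiltonian `H^F = H^Add - H_LP`, with the domain of `H_LP`. -/
def floquetHam (ω : ℝ) (h : ℤ → 𝓗 →L[ℂ] 𝓗) : FloquetSpace 𝓗 →ₗ.[ℂ] FloquetSpace 𝓗 :=
  (addHam h : FloquetSpace 𝓗 →ₗ[ℂ] FloquetSpace 𝓗).toPMap ⊤ - linPot 𝓗 ω

/-- The matrix element `⟨l|X|l'⟩`, an operator on `𝓗`. -/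
def block (X : FloquetSpace 𝓗 →L[ℂ] FloquetSpace 𝓗) (l l' : ℤ) : 𝓗 →L[ℂ] 𝓗 :=
  lp.evalCLM ℂ (fun _ : ℤ => 𝓗) 2 l ∘L X ∘L
    lp.singleContinuousLinearMap ℂ (fun _ : ℤ => 𝓗) 2 l'

variable [CompleteSpace 𝓗] {Γ : ℕ}

/-- The `κ`-th factor of the Floquet-space product formula, `κ = 1, …, 2K-1`:
`e^{-i H^F_{γ_k} α_k τ}` if `κ = 2k-1`, and `e^{-i H_LP (β_k + α_k - β_{k+1}) τ}` if `κ = 2k`. -/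
def floquetFactor (ω : ℝ) (h : Fin Γ → ℤ → 𝓗 →L[ℂ] 𝓗) (γ : ℕ → Fin Γ) (α β : ℕ → ℝ) (τ : ℝ)
    (κ : ℕ) : FloquetSpace 𝓗 →L[ℂ] FloquetSpace 𝓗 :=
  if Odd κ then expNegI (floquetHam ω (h (γ ((κ + 1) / 2)))) (α ((κ + 1) / 2) * τ)
  else expNegI (linPot 𝓗 ω) ((β (κ / 2) + α (κ / 2) - β (κ / 2 + 1)) * τ)

/-- The partial product `T^F_{≤κ}(τ)`; later factors stand on the left. -/
def floquetPartial (ω : ℝ) (h : Fin Γ → ℤ → 𝓗 →L[ℂ] 𝓗) (γ : ℕ → Fin Γ) (α β : ℕ → ℝ) (τ : ℝ) :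
    ℕ → (FloquetSpace 𝓗 →L[ℂ] FloquetSpace 𝓗)
  | 0 => 1
  | κ + 1 => floquetFactor ω h γ α β τ (κ + 1) * floquetPartial ω h γ α β τ κ

/-- The Floquet-space product formula `T^F(τ) = T^F_{≤2K-1}(τ)`. -/
def floquetFormula (ω : ℝ) (h : Fin Γ → ℤ → 𝓗 →L[ℂ] 𝓗) (K : ℕ) (γ : ℕ → Fin Γ) (α β : ℕ → ℝ)
    (τ : ℝ) : FloquetSpace 𝓗 →L[ℂ] FloquetSpace 𝓗 :=
  floquetPartial ω h γ α β τ (2 * K - 1)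

/-- The conjugation `T† X T`. -/
def conjBy (T X : FloquetSpace 𝓗 →L[ℂ] FloquetSpace 𝓗) : FloquetSpace 𝓗 →L[ℂ] FloquetSpace 𝓗 :=
  ContinuousLinearMap.adjoint T * X * T

/-- The operator
`Δ^F(τ) = ∑_γ T^F(τ)† H^Add_γ T^F(τ) - ∑_k (β_k+α_k) T^F_{≤2k-1}(τ)† H^Add_{γ_k} T^F_{≤2k-1}(τ)
  + ∑_k β_k T^F_{<2k-1}(τ)† H^Add_{γ_k} T^F_{<2k-1}(τ)`. -/
def floquetDelta (ω : ℝ) (h : Fin Γ → ℤ → 𝓗 →L[ℂ] 𝓗) (K : ℕ) (γ : ℕ → Fin Γ) (α β : ℕ → ℝ)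
    (τ : ℝ) : FloquetSpace 𝓗 →L[ℂ] FloquetSpace 𝓗 :=
  ∑ j : Fin Γ, conjBy (floquetFormula ω h K γ α β τ) (addHam (h j))
    - ∑ k ∈ Finset.Icc 1 K,
        ((β k + α k : ℝ) : ℂ) • conjBy (floquetPartial ω h γ α β τ (2 * k - 1)) (addHam (h (γ k)))
    + ∑ k ∈ Finset.Icc 1 K,
        ((β k : ℝ) : ℂ) • conjBy (floquetPartial ω h γ α β τ (2 * k - 2)) (addHam (h (γ k)))

/-- The column sum `∑_l ⟨l|Δ^F(τ)|0⟩`, an operator on `𝓗`. -/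
def deltaSum (ω : ℝ) (h : Fin Γ → ℤ → 𝓗 →L[ℂ] 𝓗) (K : ℕ) (γ : ℕ → Fin Γ) (α β : ℕ → ℝ)
    (τ : ℝ) : 𝓗 →L[ℂ] 𝓗 :=
  ∑' l : ℤ, block (floquetDelta ω h K γ α β τ) l 0

end Floquet

end

end FloquetPF

/-! The group of `linPot` is the diagonal phase `phaseOp`, and conjugating `addHam h` by `phaseOp 𝓗
ω s` multiplies its `m`-th diagonal by `e^{-imωs}`. This gives the lifted time-dependent Hamiltonian
`liftHam ω h s`. In the interaction picture, `e^{-iH^F s}` is therefore `phaseOp 𝓗 ω (-s)` times the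
evolution of `liftHam` from `0` to `s` (`expNegI_floquetHam`).

Conjugation by a phase also translates evolution times, so the phases in `T^F` telescope: each
partial product is one phase times a partial product formula for the lifted Hamiltonians
(`floquetPartial_odd`, `floquetPartial_even`). The remaining phase moves `H^Add` to the correct
time, and `Δ^F` becomes the defect `S† H S - i S† S'` of the lifted formula (`floquetDelta_eq`).

Summing the coefficients of a block Toeplitz operator with `ℓ¹` symbol evaluates the symbol at phase
zero. This respects sums, products, adjoints and time evolutions, and it sends `liftHam` to
`fourierHam`. Hence the column sum of `Δ^F` is the same defect computed in the physical space
(`hasSymbol_formulaDelta`, `HasSymbol.tsum_block`).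

In the physical space, `d/dτ (U(t,τ) S(τ,0)) = i U S (S† H S - i S† S')`. Integration over `[0,t]`
gives the identity, and unitarity of `U` and `S` gives the bound. -/

namespace FloquetPF

noncomputable section

/-! ### Linear differential equations in a Banach space -/

section LinearODE

variable {E : Type*} [NormedAddCommGroup E] [NormedSpace ℂ E] {L : ℝ → E →L[ℂ] E} {C : ℝ}

/-- The `n`-th term of the Picard–Dyson series of `X' = L X`, `X(t₀) = x`. -/
def picardTerm (L : ℝ → E →L[ℂ] E) (t₀ : ℝ) (x : E) : ℕ → ℝ → E
  | 0, _ => x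
  | n + 1, t => ∫ s in t₀..t, L s (picardTerm L t₀ x n s)

/-- The solution of `X' = L X`, `X(t₀) = x`, as the sum of its Picard–Dyson series. -/
def picardSum (L : ℝ → E →L[ℂ] E) (t₀ : ℝ) (x : E) (t : ℝ) : E :=
  ∑' n, picardTerm L t₀ x n t

theorem eq_of_hasDerivAt_linear (hC : ∀ s, ‖L s‖ ≤ C) {f g : ℝ → E} (t₀ : ℝ)
    (hf : ∀ t, HasDerivAt f (L t (f t)) t) (hg : ∀ t, HasDerivAt g (L t (g t)) t)
    (h0 : f t₀ = g t₀) : f = g := by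
  refine ODE_solution_unique_univ (v := fun t x => L t x) (s := fun _ => Set.univ)
    (K := C.toNNReal) (t₀ := t₀) (fun t => ?_) (fun t => ⟨hf t, trivial⟩)
    (fun t => ⟨hg t, trivial⟩) h0
  have h1 : LipschitzWith C.toNNReal (L t) :=
    (L t).lipschitz.weaken (by
      rw [← NNReal.coe_le_coe, coe_nnnorm]
      exact (hC t).trans (Real.le_coe_toNNReal C))
  exact h1.lipschitzOnWith

theorem picardTerm_zero_of_pos (t₀ : ℝ) (x : E) (n : ℕ) : picardTerm L t₀ x (n + 1) t₀ = 0 := by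
  simp [picardTerm]

theorem picardSum_self (t₀ : ℝ) (x : E) : picardSum L t₀ x t₀ = x := by
  rw [picardSum, tsum_eq_single 0]
  · rfl
  · rintro (_ | n) hn
    · exact absurd rfl hn
    · exact picardTerm_zero_of_pos t₀ x n

theorem continuous_picardTerm (hL : Continuous L) (t₀ : ℝ) (x : E) (n : ℕ) :
    Continuous (picardTerm L t₀ x n) := by
  induction n with
  | zero => exact continuous_const
  | succ n ih =>
    exact intervalIntegral.continuous_primitive
      (fun a b => (hL.clm_apply ih).intervalIntegrable a b) t₀

/-- The factorial is the volume of the time-ordered simplex. Integrating over the unordered interval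
covers times before `t₀` as well. -/
theorem norm_picardTerm_le (hC : ∀ s, ‖L s‖ ≤ C) (t₀ : ℝ) (x : E)
    (n : ℕ) (t : ℝ) :
    ‖picardTerm L t₀ x n t‖ ≤ ‖x‖ * ((C * |t - t₀|) ^ n / n.factorial) := by
  have hC0 : 0 ≤ C := (norm_nonneg _).trans (hC 0)
  induction n generalizing t with
  | zero => simp [picardTerm]
  | succ n ih =>
    rw [picardTerm, intervalIntegral.norm_integral_eq_norm_integral_uIoc]
    have hi : ∀ s, ‖L s (picardTerm L t₀ x n s)‖ ≤
        C * ‖x‖ * C ^ n / n.factorial * |s - t₀| ^ n := fun s => by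
      calc _ ≤ ‖L s‖ * ‖picardTerm L t₀ x n s‖ := (L s).le_opNorm _
        _ ≤ C * (‖x‖ * ((C * |s - t₀|) ^ n / n.factorial)) := by
          gcongr
          · exact hC s
          · exact ih s
        _ = _ := by rw [mul_pow]; ring
    have hint : MeasureTheory.IntegrableOn
        (fun s : ℝ => C * ‖x‖ * C ^ n / n.factorial * |s - t₀| ^ n) (Set.uIoc t₀ t) := by
      have : Continuous (fun s : ℝ => C * ‖x‖ * C ^ n / n.factorial * |s - t₀| ^ n) := by fun_prop
      exact (this.intervalIntegrable t₀ t).def'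
    refine (MeasureTheory.norm_integral_le_of_norm_le hint
      (Filter.Eventually.of_forall hi)).trans (le_of_eq ?_)
    rw [MeasureTheory.integral_const_mul, integral_pow_abs_sub_uIoc, mul_pow, Nat.factorial_succ]
    push_cast
    field_simp
    ring

variable [CompleteSpace E]

theorem hasDerivAt_picardTerm (hL : Continuous L) (t₀ : ℝ) (x : E) (n : ℕ) (t : ℝ) :
    HasDerivAt (picardTerm L t₀ x (n + 1)) (L t (picardTerm L t₀ x n t)) t := by
  have h := hL.clm_apply (continuous_picardTerm hL t₀ x n)
  exact intervalIntegral.integral_hasDerivAt_right (h.intervalIntegrable _ _)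
    (h.stronglyMeasurableAtFilter _ _) h.continuousAt

theorem summable_picardTerm (hC : ∀ s, ‖L s‖ ≤ C) (t₀ : ℝ) (x : E) (t : ℝ) :
    Summable fun n => picardTerm L t₀ x n t :=
  Summable.of_norm_bounded ((Real.summable_pow_div_factorial (C * |t - t₀|)).mul_left ‖x‖)
    fun n => norm_picardTerm_le hC t₀ x n t

theorem hasDerivAt_tsum_picardTerm_succ (hL : Continuous L) (hC : ∀ s, ‖L s‖ ≤ C)
    (t₀ : ℝ) (x : E) (t : ℝ) :
    HasDerivAt (fun z => ∑' n, picardTerm L t₀ x (n + 1) z)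
      (∑' n, L t (picardTerm L t₀ x n t)) t := by
  have hC0 : 0 ≤ C := (norm_nonneg _).trans (hC 0)
  -- Any radius exceeding `|t - t₀|` works: on the ball the derivatives have a summable majorant, so
  -- the series may be differentiated termwise.
  obtain ⟨R, hR⟩ : ∃ R, R = |t - t₀| + 1 := ⟨_, rfl⟩
  have hmem : t ∈ Metric.ball t₀ R := by
    rw [Metric.mem_ball, Real.dist_eq, hR]
    exact lt_add_one _
  have hsum : Summable fun n : ℕ => C * (‖x‖ * ((C * R) ^ n / n.factorial)) :=
    ((Real.summable_pow_div_factorial (C * R)).mul_left ‖x‖).mul_left C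
  have hbound : ∀ (n : ℕ), ∀ y ∈ Metric.ball t₀ R,
      ‖L y (picardTerm L t₀ x n y)‖ ≤ C * (‖x‖ * ((C * R) ^ n / n.factorial)) := by
    intro n y hy
    have hy' : |y - t₀| ≤ R := (Metric.mem_ball.1 hy).le
    calc _ ≤ ‖L y‖ * ‖picardTerm L t₀ x n y‖ := (L y).le_opNorm _
      _ ≤ C * (‖x‖ * ((C * |y - t₀|) ^ n / n.factorial)) :=
        mul_le_mul (hC y) (norm_picardTerm_le hC t₀ x n y) (norm_nonneg _) hC0
      _ ≤ _ := by gcongr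
  have h0 : Summable fun n => picardTerm L t₀ x (n + 1) t :=
    (summable_nat_add_iff (f := fun n => picardTerm L t₀ x n t) 1).2
      (summable_picardTerm hC t₀ x t)
  exact hasDerivAt_tsum_of_isPreconnected hsum Metric.isOpen_ball
    (convex_ball t₀ R).isPreconnected (fun n y _ => hasDerivAt_picardTerm hL t₀ x n y)
    hbound hmem h0 hmem

theorem hasDerivAt_picardSum (hL : Continuous L) (hC : ∀ s, ‖L s‖ ≤ C)
    (t₀ : ℝ) (x : E) (t : ℝ) :
    HasDerivAt (picardSum L t₀ x) (L t (picardSum L t₀ x t)) t := by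
  have hsplit : picardSum L t₀ x = fun z => x + ∑' n, picardTerm L t₀ x (n + 1) z := by
    funext z
    rw [picardSum, (summable_picardTerm hC t₀ x z).tsum_eq_zero_add]
    rfl
  have hval : L t (picardSum L t₀ x t) = ∑' n, L t (picardTerm L t₀ x n t) :=
    (L t).map_tsum (summable_picardTerm hC t₀ x t)
  rw [hval, hsplit]
  exact (hasDerivAt_tsum_picardTerm_succ hL hC t₀ x t).const_add x

end LinearODE

/-! ### The time evolution generated by a bounded norm-continuous Hamiltonian -/

section TimeEvolution

variable {𝓗 : Type*} [NormedAddCommGroup 𝓗] [InnerProductSpace ℂ 𝓗]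

/-- The iterated integrals only see times between `t₀` and `t`. This is what allows `H` to agree
with a periodic Hamiltonian on `[0,t]` only. -/
theorem dysonTerm_congr {H H' : ℝ → 𝓗 →L[ℂ] 𝓗} {t₀ : ℝ} {S : Set ℝ} (hS : S.OrdConnected)
    (h₀ : t₀ ∈ S) (hH : ∀ s ∈ S, H s = H' s) (n : ℕ) {t : ℝ} (ht : t ∈ S) :
    dysonTerm H t₀ n t = dysonTerm H' t₀ n t := by
  induction n generalizing t with
  | zero => rfl
  | succ n ih =>
    simp only [dysonTerm]
    congr 2
    refine intervalIntegral.integral_congr fun s hs => ?_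
    have hs' : s ∈ S := hS.uIcc_subset h₀ ht hs
    simp only [hH s hs', ih hs']

theorem timeEvol_congr {H H' : ℝ → 𝓗 →L[ℂ] 𝓗} {S : Set ℝ} (hS : S.OrdConnected)
    (hH : ∀ s ∈ S, H s = H' s) {t t₀ : ℝ} (ht : t ∈ S) (h₀ : t₀ ∈ S) :
    timeEvol H t t₀ = timeEvol H' t t₀ :=
  tsum_congr fun n => dysonTerm_congr hS h₀ hH n ht

variable [CompleteSpace 𝓗]

/-- A norm-continuous, uniformly bounded family of self-adjoint operators. -/
structure IsRegularHam (H : ℝ → 𝓗 →L[ℂ] 𝓗) : Prop where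
  continuous : Continuous H
  bounded : ∃ C, ∀ s, ‖H s‖ ≤ C
  selfAdjoint : ∀ s, IsSelfAdjoint (H s)

/-- The generator of the Schrödinger equation `X' = -i H X` on operators. -/
def schrodingerGen (H : ℝ → 𝓗 →L[ℂ] 𝓗) (s : ℝ) : (𝓗 →L[ℂ] 𝓗) →L[ℂ] (𝓗 →L[ℂ] 𝓗) :=
  ContinuousLinearMap.mul ℂ (𝓗 →L[ℂ] 𝓗) (-(Complex.I • H s))

theorem schrodingerGen_apply (H : ℝ → 𝓗 →L[ℂ] 𝓗) (s : ℝ) (X : 𝓗 →L[ℂ] 𝓗) :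
    schrodingerGen H s X = -(Complex.I • (H s * X)) := by
  simp [schrodingerGen]

theorem dysonTerm_eq_picardTerm (H : ℝ → 𝓗 →L[ℂ] 𝓗) (t₀ : ℝ) (n : ℕ) (t : ℝ) :
    dysonTerm H t₀ n t = picardTerm (schrodingerGen H) t₀ 1 n t := by
  induction n generalizing t with
  | zero => rfl
  | succ n ih =>
    simp only [dysonTerm, picardTerm, schrodingerGen_apply, ← ih]
    rw [intervalIntegral.integral_neg, intervalIntegral.integral_smul]

theorem timeEvol_eq_picardSum (H : ℝ → 𝓗 →L[ℂ] 𝓗) (t t₀ : ℝ) :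
    timeEvol H t t₀ = picardSum (schrodingerGen H) t₀ 1 t :=
  tsum_congr fun n => dysonTerm_eq_picardTerm H t₀ n t

theorem timeEvol_self (H : ℝ → 𝓗 →L[ℂ] 𝓗) (t : ℝ) : timeEvol H t t = 1 := by
  rw [timeEvol_eq_picardSum, picardSum_self]

variable {H : ℝ → 𝓗 →L[ℂ] 𝓗}

theorem continuous_schrodingerGen (hH : Continuous H) : Continuous (schrodingerGen H) :=
  (ContinuousLinearMap.continuous _).comp (hH.const_smul Complex.I).neg

theorem norm_schrodingerGen_le (H : ℝ → 𝓗 →L[ℂ] 𝓗) (s : ℝ) : ‖schrodingerGen H s‖ ≤ ‖H s‖ := by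
  refine (ContinuousLinearMap.opNorm_mul_apply_le ℂ _ _).trans ?_
  rw [norm_neg, norm_smul, Complex.norm_I, one_mul]

namespace IsRegularHam

theorem hasDerivAt_timeEvol (h : IsRegularHam H) (t₀ t : ℝ) :
    HasDerivAt (fun t => timeEvol H t t₀) (-(Complex.I • (H t * timeEvol H t t₀))) t := by
  obtain ⟨C, hC⟩ := h.bounded
  have := hasDerivAt_picardSum (L := schrodingerGen H) (continuous_schrodingerGen h.continuous)
    (fun s => (norm_schrodingerGen_le H s).trans (hC s)) t₀ 1 t
  rw [schrodingerGen_apply] at this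
  simpa only [timeEvol_eq_picardSum] using this

/-- Right multiplication by a constant preserves the equation, so uniqueness applies. The cocycle
law, the translation covariance and the transfer of evolutions between spaces all follow from this.
-/
theorem eq_timeEvol_mul (h : IsRegularHam H) {X : ℝ → 𝓗 →L[ℂ] 𝓗}
    (hX : ∀ t, HasDerivAt X (-(Complex.I • (H t * X t))) t) (t s : ℝ) :
    X t = timeEvol H t s * X s := by
  obtain ⟨C, hC⟩ := h.bounded
  refine congrFun (eq_of_hasDerivAt_linear (L := schrodingerGen H)
    (g := fun t => timeEvol H t s * X s)
    (fun s => (norm_schrodingerGen_le H s).trans (hC s)) s (fun t => ?_) (fun t => ?_) ?_) t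
  · rw [schrodingerGen_apply]; exact hX t
  · rw [schrodingerGen_apply]
    refine ((h.hasDerivAt_timeEvol s t).mul_const (X s)).congr_deriv ?_
    simp [mul_assoc]
  · simp [timeEvol_self]

theorem timeEvol_mul_timeEvol (h : IsRegularHam H) (t s r : ℝ) :
    timeEvol H t s * timeEvol H s r = timeEvol H t r :=
  (h.eq_timeEvol_mul (h.hasDerivAt_timeEvol r) t s).symm

theorem star_timeEvol_mul_self (h : IsRegularHam H) (t s : ℝ) :
    star (timeEvol H t s) * timeEvol H t s = 1 := by
  have hd : ∀ t, HasDerivAt (fun t => star (timeEvol H t s) * timeEvol H t s) 0 t := fun t => by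
    refine ((h.hasDerivAt_timeEvol s t).star.mul (h.hasDerivAt_timeEvol s t)).congr_deriv ?_
    simp [star_smul, (h.selfAdjoint t).star_eq, mul_assoc]
  have := is_const_of_deriv_eq_zero (fun t => (hd t).differentiableAt) (fun t => (hd t).deriv) t s
  simpa [timeEvol_self] using this

/-- The cocycle law supplies a right inverse, which must coincide with the left inverse `star
(timeEvol H t s)`. In infinite dimension, this upgrades an isometry to a unitary. -/
theorem star_timeEvol (h : IsRegularHam H) (t s : ℝ) :
    star (timeEvol H t s) = timeEvol H s t := by
  calc star (timeEvol H t s) = star (timeEvol H t s) * (timeEvol H t s * timeEvol H s t) := by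
        rw [h.timeEvol_mul_timeEvol, timeEvol_self, mul_one]
    _ = _ := by rw [← mul_assoc, h.star_timeEvol_mul_self, one_mul]

theorem timeEvol_mem_unitary (h : IsRegularHam H) (t s : ℝ) :
    timeEvol H t s ∈ unitary (𝓗 →L[ℂ] 𝓗) := by
  refine Unitary.mem_iff.2 ⟨h.star_timeEvol_mul_self t s, ?_⟩
  rw [h.star_timeEvol, h.timeEvol_mul_timeEvol, timeEvol_self]

theorem hasDerivAt_timeEvol_right (h : IsRegularHam H) (t s : ℝ) :
    HasDerivAt (fun s => timeEvol H t s) (Complex.I • (timeEvol H t s * H s)) s := by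
  have := (h.hasDerivAt_timeEvol t s).star
  simp only [h.star_timeEvol] at this
  refine this.congr_deriv ?_
  simp [star_smul, (h.selfAdjoint s).star_eq, h.star_timeEvol]

/-- The derivative of `τ ↦ U(aτ, bτ)`. -/
theorem hasDerivAt_timeEvol_mul (h : IsRegularHam H) (a b τ : ℝ) :
    HasDerivAt (fun τ => timeEvol H (a * τ) (b * τ))
      (-(Complex.I • ((a : ℂ) • (H (a * τ) * timeEvol H (a * τ) (b * τ))
        - (b : ℂ) • (timeEvol H (a * τ) (b * τ) * H (b * τ))))) τ := by
  have ha : HasDerivAt (fun τ : ℝ => a * τ) a τ := by simpa using (hasDerivAt_id τ).const_mul a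
  have hb : HasDerivAt (fun τ : ℝ => b * τ) b τ := by simpa using (hasDerivAt_id τ).const_mul b
  have h1 := (h.hasDerivAt_timeEvol 0 (a * τ)).scomp τ ha
  have h2 := (h.hasDerivAt_timeEvol_right 0 (b * τ)).scomp τ hb
  -- Factoring through the fixed time `0` separates the two occurrences of `τ`, so the ordinary
  -- product rule applies.
  have he : (fun τ : ℝ => timeEvol H (a * τ) (b * τ)) =
      fun τ => timeEvol H (a * τ) 0 * timeEvol H 0 (b * τ) := by
    funext τ
    rw [h.timeEvol_mul_timeEvol]
  have e1 : ∀ X, timeEvol H (a * τ) 0 * (timeEvol H 0 (b * τ) * X) =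
      timeEvol H (a * τ) (b * τ) * X := fun X => by
    rw [← mul_assoc, h.timeEvol_mul_timeEvol]
  rw [he]
  refine (h1.mul h2).congr_deriv ?_
  simp only [Function.comp, smul_mul_assoc, mul_smul_comm, neg_mul, smul_neg, e1, mul_assoc,
    h.timeEvol_mul_timeEvol, Complex.coe_smul, smul_sub, smul_comm Complex.I]
  abel

end IsRegularHam

end TimeEvolution

/-! ### Unitary groups are determined by their generators -/

section UnitaryGroups

variable {E : Type*} [NormedAddCommGroup E] [InnerProductSpace ℂ E] [CompleteSpace E]
  {A : E →ₗ.[ℂ] E} {V W : ℝ → E →L[ℂ] E}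

namespace IsUnitaryGroup

theorem apply_mem_graph (hV : IsUnitaryGroup A V) {x y : E} (h : (x, y) ∈ A.graph) (s : ℝ) :
    (V s x, V s y) ∈ A.graph := by
  rw [hV.generator] at h ⊢
  have h1 := ((V s).restrictScalars ℝ).hasFDerivAt.comp_hasDerivAt 0 h
  refine (h1.congr_deriv (by simp)).congr_of_eventuallyEq (Filter.Eventually.of_forall fun t => ?_)
  have : V t * V s = V s * V t := by rw [← hV.map_add, ← hV.map_add, add_comm]
  exact DFunLike.congr_fun this x

theorem hasDerivAt_apply (hV : IsUnitaryGroup A V) {x y : E} (h : (x, y) ∈ A.graph) (s : ℝ) :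
    HasDerivAt (fun t => V t x) (-(Complex.I • V s y)) s := by
  have h1 := (hV.generator _ _).1 (hV.apply_mem_graph h s)
  rw [← sub_self s] at h1
  refine (h1.comp_sub_const s s).congr_of_eventuallyEq (Filter.Eventually.of_forall fun t => ?_)
  have : V t = V (t - s) * V s := by rw [← hV.map_add, sub_add_cancel]
  exact DFunLike.congr_fun this x

theorem inner_apply_apply (hV : IsUnitaryGroup A V) (t : ℝ) (x y : E) :
    inner ℂ (V t x) (V t y) = inner ℂ x y := by
  rw [← ContinuousLinearMap.adjoint_inner_right, ← mul_apply_eq_comp,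
    ← ContinuousLinearMap.star_eq_adjoint, Unitary.star_mul_self_of_mem (hV.mem_unitary t)]
  rfl

theorem norm_apply (hV : IsUnitaryGroup A V) (t : ℝ) (x : E) : ‖V t x‖ = ‖x‖ :=
  ContinuousLinearMap.norm_map_of_mem_unitary (hV.mem_unitary t) x

/-- The generator of a unitary group is symmetric. -/
theorem inner_symm (hV : IsUnitaryGroup A V) {x y x' y' : E} (h : (x, y) ∈ A.graph)
    (h' : (x', y') ∈ A.graph) : inner ℂ y x' = inner ℂ x y' := by
  have h1 := ((hV.generator _ _).1 h).inner ℂ ((hV.generator _ _).1 h')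
  simp only [hV.inner_apply_apply, hV.map_zero, one_apply_eq_self, inner_neg_right,
    inner_smul_right, inner_neg_left, inner_smul_left, Complex.conj_I] at h1
  have h2 := h1.unique (hasDerivAt_const _ _)
  have h3 : Complex.I * (inner ℂ y x' - inner ℂ x y') = 0 := by linear_combination h2
  exact sub_eq_zero.1 ((mul_eq_zero.1 h3).resolve_left Complex.I_ne_zero)

/-- Symmetry of the generator makes `⟨V s x, W s x⟩` constant in `s`. Expanding `‖V t x - W t x‖²`
with both orbits of norm `‖x‖` then gives zero. -/
theorem eq_apply_of_mem_graph (hV : IsUnitaryGroup A V) (hW : IsUnitaryGroup A W) {x y : E}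
    (h : (x, y) ∈ A.graph) (t : ℝ) : V t x = W t x := by
  have hd : ∀ s, HasDerivAt (fun s => (inner ℂ (V s x) (W s x) : ℂ)) 0 s := fun s => by
    refine ((hV.hasDerivAt_apply h s).inner ℂ (hW.hasDerivAt_apply h s)).congr_deriv ?_
    have := hV.inner_symm (hV.apply_mem_graph h s) (hW.apply_mem_graph h s)
    simp only [inner_neg_right, inner_smul_right, inner_neg_left, inner_smul_left,
      Complex.conj_I, this]
    ring
  have h1 : (inner ℂ (V t x) (W t x) : ℂ) = inner ℂ x x := by
    have := is_const_of_deriv_eq_zero (fun t => (hd t).differentiableAt)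
      (fun t => (hd t).deriv) t 0
    simpa [hV.map_zero, hW.map_zero] using this
  have h2 : ‖V t x - W t x‖ ^ 2 = 0 := by
    rw [@norm_sub_sq ℂ, h1, hV.norm_apply, hW.norm_apply, inner_self_eq_norm_sq]
    ring
  exact sub_eq_zero.1 (norm_eq_zero.1 (pow_eq_zero_iff two_ne_zero |>.1 h2))

theorem unique (hA : Dense (A.domain : Set E)) (hV : IsUnitaryGroup A V)
    (hW : IsUnitaryGroup A W) : V = W := by
  funext t
  refine ContinuousLinearMap.coeFn_injective
    (Continuous.ext_on hA (V t).continuous (W t).continuous fun x hx => ?_)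
  exact hV.eq_apply_of_mem_graph hW (A.mem_graph ⟨x, hx⟩) t

/-- `expNegI` picks some group by choice; uniqueness lets any explicitly constructed group replace
it. -/
theorem expNegI_eq (hA : Dense (A.domain : Set E)) (hV : IsUnitaryGroup A V) (t : ℝ) :
    expNegI A t = V t := by
  have h : ∃ V : ℝ → E →L[ℂ] E, IsUnitaryGroup A V := ⟨V, hV⟩
  rw [expNegI, dif_pos h, unique hA h.choose_spec hV]

end IsUnitaryGroup

end UnitaryGroups

/-! ### The unitary group of the linear potential -/

theorem summable_norm_sq {F : Type*} [NormedAddCommGroup F] (ψ : FloquetSpace F) :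
    Summable fun l => ‖ψ l‖ ^ 2 := by
  simpa using (lp.memℓp ψ).summable (by norm_num)

theorem norm_sq_eq_tsum {F : Type*} [NormedAddCommGroup F] (ψ : FloquetSpace F) :
    ‖ψ‖ ^ 2 = ∑' l, ‖ψ l‖ ^ 2 := by
  simpa using lp.norm_rpow_eq_tsum (p := 2) (by norm_num) ψ

section LinearPotential

variable {𝓗 : Type*} [NormedAddCommGroup 𝓗] [InnerProductSpace ℂ 𝓗]

/-- The phase `e^{-ilωs}`. -/
def phase (ω : ℝ) (l : ℤ) (s : ℝ) : ℂ := Complex.exp (-(Complex.I * l * ω * s))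

theorem norm_phase (ω : ℝ) (l : ℤ) (s : ℝ) : ‖phase ω l s‖ = 1 := by
  have : phase ω l s = Complex.exp (((-(l * ω * s) : ℝ) : ℂ) * Complex.I) := by
    rw [phase]
    push_cast
    ring_nf
  rw [this, Complex.norm_exp_ofReal_mul_I]

theorem phase_add_right (ω : ℝ) (l : ℤ) (s t : ℝ) :
    phase ω l (s + t) = phase ω l s * phase ω l t := by
  rw [phase, phase, phase, ← Complex.exp_add]
  push_cast
  ring_nf

theorem phase_add_left (ω : ℝ) (l m : ℤ) (s : ℝ) :
    phase ω (l + m) s = phase ω l s * phase ω m s := by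
  rw [phase, phase, phase, ← Complex.exp_add]
  push_cast
  ring_nf

@[simp]
theorem phase_zero_right (ω : ℝ) (l : ℤ) : phase ω l 0 = 1 := by simp [phase]

theorem conj_phase (ω : ℝ) (l : ℤ) (s : ℝ) :
    (starRingEnd ℂ) (phase ω l s) = phase ω l (-s) := by
  rw [phase, phase, ← Complex.exp_conj]
  simp

theorem hasDerivAt_phase (ω : ℝ) (l : ℤ) (s : ℝ) :
    HasDerivAt (phase ω l) (-(Complex.I * l * ω) * phase ω l s) s := by
  have h1 : HasDerivAt (fun s : ℝ => -(Complex.I * l * ω * (s : ℂ))) (-(Complex.I * l * ω)) s := by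
    have := ((hasDerivAt_id s).ofReal_comp.const_mul (Complex.I * l * ω)).fun_neg
    simpa using this
  have := h1.cexp
  rw [mul_comm]
  exact this

theorem continuous_phase (ω : ℝ) (l : ℤ) : Continuous (phase ω l) :=
  continuous_iff_continuousAt.2 fun s => (hasDerivAt_phase ω l s).continuousAt

/-- The diagonal operator `∑_l e^{-ilωs} |l⟩⟨l| ⊗ I`. -/
def phaseOp (𝓗 : Type*) [NormedAddCommGroup 𝓗] [InnerProductSpace ℂ 𝓗] (ω s : ℝ) :
    FloquetSpace 𝓗 →L[ℂ] FloquetSpace 𝓗 :=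
  lp.mapCLM 2 (fun l : ℤ => phase ω l s • ContinuousLinearMap.id ℂ 𝓗) zero_le_one fun l => by
    rw [norm_smul, norm_phase, one_mul]
    exact ContinuousLinearMap.norm_id_le

@[simp]
theorem phaseOp_apply (ω s : ℝ) (ψ : FloquetSpace 𝓗) (l : ℤ) :
    phaseOp 𝓗 ω s ψ l = phase ω l s • ψ l := by
  simp [phaseOp]

theorem phaseOp_add (ω s t : ℝ) : phaseOp 𝓗 ω (s + t) = phaseOp 𝓗 ω s * phaseOp 𝓗 ω t := by
  ext ψ l
  simp [phase_add_right, mul_smul]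

theorem phaseOp_zero (ω : ℝ) : phaseOp 𝓗 ω 0 = 1 := by
  ext ψ l
  simp

theorem phaseOp_mul_phaseOp_neg (ω s : ℝ) : phaseOp 𝓗 ω s * phaseOp 𝓗 ω (-s) = 1 := by
  rw [← phaseOp_add, add_neg_cancel, phaseOp_zero]

theorem phaseOp_neg_mul_phaseOp (ω s : ℝ) : phaseOp 𝓗 ω (-s) * phaseOp 𝓗 ω s = 1 := by
  rw [← phaseOp_add, neg_add_cancel, phaseOp_zero]

theorem continuous_phaseOp_apply (ω : ℝ) (ψ : FloquetSpace 𝓗) :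
    Continuous fun s => phaseOp 𝓗 ω s ψ := by
  refine continuous_iff_continuousAt.2 fun s₀ => ?_
  have h1 : Continuous fun s => ‖phaseOp 𝓗 ω s ψ - phaseOp 𝓗 ω s₀ ψ‖ ^ 2 := by
    simp only [norm_sq_eq_tsum, lp.coeFn_sub, Pi.sub_apply, phaseOp_apply, ← sub_smul, norm_smul]
    -- Two unit phases differ by at most `2`, hence the factor `2 ^ 2`.
    refine continuous_tsum (u := fun l => 2 ^ 2 * ‖ψ l‖ ^ 2) (fun l => ?_)
      ((summable_norm_sq ψ).mul_left _) fun l s => ?_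
    · exact ((((continuous_phase ω l).sub continuous_const).norm).mul continuous_const).pow 2
    · rw [Real.norm_of_nonneg (by positivity), mul_pow]
      gcongr
      refine (norm_sub_le _ _).trans ?_
      rw [norm_phase, norm_phase]
      norm_num
  have h2 := (h1.tendsto s₀).sqrt
  simp only [Real.sqrt_sq (norm_nonneg _), sub_self, norm_zero, Real.sqrt_zero, ne_eq,
    OfNat.ofNat_ne_zero, not_false_eq_true, zero_pow] at h2
  exact tendsto_iff_norm_sub_tendsto_zero.2 h2

theorem mem_graph_linPot {ω : ℝ} {ψ φ : FloquetSpace 𝓗} :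
    (ψ, φ) ∈ (linPot 𝓗 ω).graph ↔ ∀ l, φ l = ((l : ℂ) * (ω : ℂ)) • ψ l := by
  rw [LinearPMap.mem_graph_iff]
  constructor
  · rintro ⟨x, rfl, rfl⟩ l
    rfl
  · intro h
    refine ⟨⟨ψ, ?_⟩, rfl, ?_⟩
    · change Memℓp (fun l : ℤ => ((l : ℂ) * (ω : ℂ)) • ψ l) 2
      rw [← funext h]
      exact lp.memℓp φ
    · exact lp.ext (funext fun l => (h l).symm)

/-- Finite truncations of a vector lie in the domain and converge to it. -/
theorem dense_linPot_domain (ω : ℝ) : Dense ((linPot 𝓗 ω).domain : Set (FloquetSpace 𝓗)) := by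
  intro ψ
  refine mem_closure_of_tendsto (lp.hasSum_single (by norm_num) ψ)
    (Filter.Eventually.of_forall fun s => ?_)
  refine Submodule.sum_mem _ fun l _ => ?_
  refine LinearPMap.mem_domain_of_mem_graph (y := lp.single 2 l (((l : ℂ) * (ω : ℂ)) • ψ l))
    (mem_graph_linPot.2 fun m => ?_)
  by_cases h : m = l
  · subst h; simp
  · simp [h]

variable [CompleteSpace 𝓗]

theorem star_phaseOp (ω s : ℝ) : star (phaseOp 𝓗 ω s) = phaseOp 𝓗 ω (-s) := by
  rw [ContinuousLinearMap.star_eq_adjoint, eq_comm, ContinuousLinearMap.eq_adjoint_iff]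
  intro ψ φ
  rw [lp.inner_eq_tsum, lp.inner_eq_tsum]
  refine tsum_congr fun l => ?_
  rw [phaseOp_apply, phaseOp_apply, inner_smul_left, inner_smul_right, conj_phase, neg_neg]

theorem phaseOp_mem_unitary (ω s : ℝ) :
    phaseOp 𝓗 ω s ∈ unitary (FloquetSpace 𝓗 →L[ℂ] FloquetSpace 𝓗) := by
  rw [Unitary.mem_iff, star_phaseOp]
  exact ⟨phaseOp_neg_mul_phaseOp ω s, phaseOp_mul_phaseOp_neg ω s⟩

/-- Coordinatewise derivatives alone do not give a derivative in `ℓ²`, but an integral identity may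
be checked coordinatewise. With strong continuity of the integrand, it then yields the norm
derivative. -/
theorem phaseOp_apply_eq_integral {ω : ℝ} {ψ φ : FloquetSpace 𝓗}
    (h : ∀ l, φ l = ((l : ℂ) * (ω : ℂ)) • ψ l) (s : ℝ) :
    phaseOp 𝓗 ω s ψ = ψ + ∫ r in (0 : ℝ)..s, -(Complex.I • phaseOp 𝓗 ω r φ) := by
  have hc : Continuous fun r => -(Complex.I • phaseOp 𝓗 ω r φ) :=
    ((continuous_phaseOp_apply ω φ).const_smul Complex.I).neg
  refine lp.ext (funext fun l => ?_)
  have h1 : (∫ r in (0 : ℝ)..s, -(Complex.I • phaseOp 𝓗 ω r φ) : FloquetSpace 𝓗) l =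
      ∫ r in (0 : ℝ)..s, (-(Complex.I • phaseOp 𝓗 ω r φ) : FloquetSpace 𝓗) l :=
    ((lp.evalCLM ℂ (fun _ : ℤ => 𝓗) 2 l).intervalIntegral_comp_comm
      (hc.intervalIntegrable 0 s)).symm
  have hd : ∀ r, HasDerivAt (fun r => phase ω l r • ψ l)
      ((-(Complex.I • phaseOp 𝓗 ω r φ) : FloquetSpace 𝓗) l) r := fun r => by
    refine ((hasDerivAt_phase ω l r).smul_const (ψ l)).congr_deriv ?_
    simp only [lp.coeFn_smul, Pi.smul_apply, phaseOp_apply, h l, smul_smul, ← neg_smul]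
    ring_nf
  have h2 := intervalIntegral.integral_eq_sub_of_hasDerivAt (a := 0) (b := s)
    (fun r _ => hd r)
    (((lp.evalCLM ℂ (fun _ : ℤ => 𝓗) 2 l).continuous.comp hc).intervalIntegrable 0 s)
  rw [lp.coeFn_add, Pi.add_apply, h1, h2, phaseOp_apply]
  simp

theorem isUnitaryGroup_phaseOp (ω : ℝ) : IsUnitaryGroup (linPot 𝓗 ω) (phaseOp 𝓗 ω) where
  mem_unitary := phaseOp_mem_unitary ω
  map_zero := phaseOp_zero ω
  map_add := phaseOp_add ω
  continuous := continuous_phaseOp_apply ω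
  generator ψ φ := by
    rw [mem_graph_linPot]
    constructor
    · intro h
      have hc : Continuous fun r => -(Complex.I • phaseOp 𝓗 ω r φ) :=
        ((continuous_phaseOp_apply ω φ).const_smul Complex.I).neg
      have hd := (intervalIntegral.integral_hasDerivAt_right (hc.intervalIntegrable 0 0)
        (hc.stronglyMeasurableAtFilter _ _) hc.continuousAt).const_add ψ
      refine (hd.congr_deriv (by simp [phaseOp_zero])).congr_of_eventuallyEq
        (Filter.Eventually.of_forall fun s => phaseOp_apply_eq_integral h s)
    -- Conversely, evaluation at `l` is bounded, so a norm derivative forces the derivative of each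
    -- coordinate and determines `φ l`.
    · intro h l
      have h1 := ((lp.evalCLM ℂ (fun _ : ℤ => 𝓗) 2 l).restrictScalars
        ℝ).hasFDerivAt.comp_hasDerivAt 0 h
      have h2 := (hasDerivAt_phase ω l 0).smul_const (ψ l)
      have h3 : HasDerivAt (fun r => phase ω l r • ψ l) (-(Complex.I • φ l)) 0 :=
        h1.congr_of_eventuallyEq (Filter.Eventually.of_forall fun r => (phaseOp_apply ω r ψ l).symm)
      have h4 := h3.unique h2
      rw [phase_zero_right, mul_one, neg_smul, neg_inj, mul_assoc, mul_smul] at h4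
      exact smul_right_injective 𝓗 Complex.I_ne_zero h4

end LinearPotential

/-! ### Bounded time-covariant perturbations of a unitary group -/

section Perturbation

variable {E : Type*} [NormedAddCommGroup E] [InnerProductSpace ℂ E] [CompleteSpace E]
  {A B : E →ₗ.[ℂ] E} {V : ℝ → E →L[ℂ] E} {L : ℝ → E →L[ℂ] E}

namespace IsUnitaryGroup

theorem mul_neg_self (hV : IsUnitaryGroup A V) (s : ℝ) : V s * V (-s) = 1 := by
  rw [← hV.map_add, add_neg_cancel, hV.map_zero]

theorem neg_mul_self (hV : IsUnitaryGroup A V) (s : ℝ) : V (-s) * V s = 1 := by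
  rw [← hV.map_add, neg_add_cancel, hV.map_zero]

/-- Conjugation by the group translates the time evolution generated by a covariant family. -/
theorem mul_timeEvol_mul (hV : IsUnitaryGroup A V) (hL : IsRegularHam L)
    (hcov : ∀ r s, V r * L s * V (-r) = L (s + r)) (r s s₀ : ℝ) :
    V r * timeEvol L s s₀ * V (-r) = timeEvol L (s + r) (s₀ + r) := by
  -- Covariance turns the generator `L (t - r)` into `L t` under conjugation, so the shifted
  -- conjugate solves the original equation; it equals `1` at `t = s₀ + r`.
  have hX : ∀ t, HasDerivAt (fun t => V r * timeEvol L (t - r) s₀ * V (-r))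
      (-(Complex.I • (L t * (V r * timeEvol L (t - r) s₀ * V (-r))))) t := fun t => by
    refine ((((hL.hasDerivAt_timeEvol s₀ (t - r)).comp_sub_const t r).const_mul
      (V r)).mul_const (V (-r))).congr_deriv ?_
    have h1 : L t * V r = V r * L (t - r) := by
      have := hcov r (t - r)
      rw [sub_add_cancel] at this
      rw [← this, mul_assoc, hV.neg_mul_self, mul_one]
    rw [mul_neg, neg_mul, mul_smul_comm, smul_mul_assoc, ← mul_assoc (L t),
      ← mul_assoc (L t), h1]
    simp only [mul_assoc]
  have h2 := hL.eq_timeEvol_mul hX (s + r) (s₀ + r)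
  simpa only [add_sub_cancel_right, timeEvol_self, mul_one, hV.mul_neg_self] using h2

/-- `V` is only strongly continuous, so no operator-norm product rule is available. Since `g 0 = 0`,
the difference quotient is `V (-s)` applied to that of `g`, and isometry together with strong
continuity gives the limit. -/
theorem hasDerivAt_neg_apply (hV : IsUnitaryGroup A V) {g : ℝ → E} {g' : E}
    (h0 : g 0 = 0) (hg : HasDerivAt g g' 0) :
    HasDerivAt (fun s => V (-s) (g s)) g' 0 := by
  rw [hasDerivAt_iff_tendsto_slope_zero] at hg ⊢
  simp only [h0, zero_add, sub_zero] at hg ⊢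
  have h1 : Filter.Tendsto (fun s => V (-s) (s⁻¹ • g s - g')) (nhdsWithin 0 {0}ᶜ)
      (nhds 0) := by
    rw [tendsto_zero_iff_norm_tendsto_zero]
    simp only [hV.norm_apply]
    exact tendsto_iff_norm_sub_tendsto_zero.1 hg
  have h2 : Filter.Tendsto (fun s => V (-s) g') (nhdsWithin 0 {0}ᶜ) (nhds g') := by
    have h3 : Continuous fun s => V (-s) g' := (hV.continuous g').comp continuous_neg
    have := (h3.tendsto 0).mono_left (nhdsWithin_le_nhds (s := {0}ᶜ))
    simpa [hV.map_zero] using this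
  have h3 := h1.add h2
  rw [zero_add] at h3
  refine h3.congr fun s => ?_
  rw [map_sub, sub_add_cancel, _root_.map_zero (V (-0)), sub_zero]
  exact ((V (-s)).restrictScalars ℝ).map_smul s⁻¹ (g s)

/-- Split `V (-s) (U x)` as `V (-s) x + V (-s) (U x - x)`. The second summand is always
differentiable at `0`, so differentiability rests on `V` alone: a bounded perturbation leaves the
domain unchanged. -/
theorem hasDerivAt_neg_mul_timeEvol_iff (hV : IsUnitaryGroup A V) (hL : IsRegularHam L) (x y : E) :
    HasDerivAt (fun s => (V (-s) * timeEvol L s 0) x) (-(Complex.I • y)) 0 ↔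
      HasDerivAt (fun s => V s x) (-(Complex.I • (L 0 x - y))) 0 := by
  obtain ⟨g, hg⟩ : ∃ g : ℝ → E, g = fun s => timeEvol L s 0 x - x := ⟨_, rfl⟩
  have hg' : HasDerivAt g (-(Complex.I • L 0 x)) 0 := by
    have h1 := ((ContinuousLinearMap.apply ℂ E
      x).restrictScalars ℝ).hasFDerivAt.comp_hasDerivAt 0 (hL.hasDerivAt_timeEvol 0 0)
    rw [hg]
    refine (h1.sub_const x).congr_deriv ?_
    simp [timeEvol_self]
  have hg0 : g 0 = 0 := by simp [hg, timeEvol_self]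
  have h1 := hV.hasDerivAt_neg_apply hg0 hg'
  have e1 : (fun s => (V (-s) * timeEvol L s 0) x) = fun s => V (-s) x + V (-s) (g s) := by
    funext s
    simp [hg]
  have flip : ∀ {f : ℝ → E} {f' : E}, HasDerivAt f f' 0 →
      HasDerivAt (fun s => f (-s)) (-f') 0 := fun {f f'} hf => by
    have hf' : HasDerivAt f f' (-0) := by rwa [neg_zero]
    exact (hf'.scomp (0 : ℝ) (hasDerivAt_neg (0 : ℝ))).congr_deriv (by simp)
  rw [e1]
  constructor
  · intro hF
    have h2 := flip (hF.sub h1)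
    simp only [Pi.sub_apply, add_sub_cancel_right, neg_neg] at h2
    refine h2.congr_deriv ?_
    rw [smul_sub]
    abel
  · intro h
    refine ((flip h).add h1).congr_deriv ?_
    rw [smul_sub]
    abel

theorem continuous_neg_mul_timeEvol_apply (hV : IsUnitaryGroup A V) (hL : IsRegularHam L) (x : E) :
    Continuous fun s => (V (-s) * timeEvol L s 0) x := by
  have hc : Continuous fun s => timeEvol L s 0 x :=
    (continuous_iff_continuousAt.2 fun s =>
      (hL.hasDerivAt_timeEvol 0 s).continuousAt).clm_apply continuous_const
  refine continuous_iff_continuousAt.2 fun s₀ => tendsto_iff_norm_sub_tendsto_zero.2 ?_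
  have h1 : Continuous fun s => ‖timeEvol L s 0 x - timeEvol L s₀ 0 x‖ +
      ‖V (-s) (timeEvol L s₀ 0 x) - V (-s₀) (timeEvol L s₀ 0 x)‖ :=
    (hc.sub continuous_const).norm.add
      (((hV.continuous _).comp continuous_neg).sub continuous_const).norm
  have h2 := h1.tendsto s₀
  simp only [sub_self, norm_zero, add_zero] at h2
  refine squeeze_zero (fun s => norm_nonneg _) (fun s => ?_) h2
  rw [← hV.norm_apply (-s) (timeEvol L s 0 x - timeEvol L s₀ 0 x), map_sub]
  exact norm_sub_le_norm_sub_add_norm_sub _ _ _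

/-- If `V s = e^{-iAs}` and `V r L(s) V(-r) = L(s + r)`, then the unitary group of `L(0) - A` is
`V(-s) 𝒯 exp(-i ∫₀ˢ L(r) dr)`. -/
theorem neg_mul_timeEvol (hV : IsUnitaryGroup A V) (hL : IsRegularHam L)
    (hcov : ∀ r s, V r * L s * V (-r) = L (s + r))
    (hB : ∀ x y, (x, y) ∈ B.graph ↔ (x, L 0 x - y) ∈ A.graph) :
    IsUnitaryGroup B (fun s => V (-s) * timeEvol L s 0) where
  mem_unitary s := mul_mem (hV.mem_unitary _) (hL.timeEvol_mem_unitary s 0)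
  map_zero := by rw [neg_zero, hV.map_zero, timeEvol_self, mul_one]
  map_add s t := by
    have h1 := hV.mul_timeEvol_mul hL hcov t s 0
    rw [zero_add] at h1
    rw [← hL.timeEvol_mul_timeEvol (s + t) t 0, ← h1, neg_add_rev, add_comm (-t), hV.map_add]
    calc _ = V (-s) * (V (-t) * V t) * timeEvol L s 0 * V (-t) * timeEvol L t 0 := by
          simp only [mul_assoc]
      _ = _ := by
          rw [hV.neg_mul_self, mul_one]
          simp only [mul_assoc]
  continuous := hV.continuous_neg_mul_timeEvol_apply hL
  generator x y := by rw [hB, hV.hasDerivAt_neg_mul_timeEvol_iff hL, hV.generator]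

end IsUnitaryGroup

end Perturbation

/-! ### Operator-valued Fourier series -/

section FourierSeries

variable {𝓗 : Type*} [NormedAddCommGroup 𝓗] [InnerProductSpace ℂ 𝓗]

theorem norm_phase_smul {F : Type*} [NormedAddCommGroup F] [NormedSpace ℂ F] (ω : ℝ) (m : ℤ)
    (s : ℝ) (x : F) : ‖phase ω m s • x‖ = ‖x‖ := by
  rw [norm_smul, norm_phase, one_mul]

section BanachSpace

variable {F : Type*} [NormedAddCommGroup F] [NormedSpace ℂ F] {a b : ℤ → F}

theorem norm_tsum_phase_smul_le (ω : ℝ) (ha : Summable fun m => ‖a m‖) (s : ℝ) :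
    ‖∑' m, phase ω m s • a m‖ ≤ ∑' m, ‖a m‖ := by
  refine (norm_tsum_le_tsum_norm (by simpa only [norm_phase_smul] using ha)).trans_eq ?_
  simp only [norm_phase_smul]

variable [CompleteSpace F]

theorem summable_phase_smul (ω s : ℝ) (ha : Summable fun m => ‖a m‖) :
    Summable fun m => phase ω m s • a m :=
  Summable.of_norm (by simpa only [norm_phase_smul] using ha)

theorem continuous_tsum_phase_smul (ω : ℝ) (ha : Summable fun m => ‖a m‖) :
    Continuous fun s => ∑' m, phase ω m s • a m :=
  continuous_tsum (fun m => (continuous_phase ω m).smul continuous_const) ha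
    fun m s => (norm_phase_smul ω m s (a m)).le

theorem integral_phase {ω : ℝ} (hω : ω ≠ 0) (m : ℤ) :
    ∫ s in (0 : ℝ)..(2 * Real.pi / ω), phase ω m s =
      if m = 0 then ((2 * Real.pi / ω : ℝ) : ℂ) else 0 := by
  split_ifs with h
  · simp [h, phase]
  · have hω' : (ω : ℂ) ≠ 0 := by exact_mod_cast hω
    have hc : -(Complex.I * m * ω) ≠ 0 := by
      simp [Complex.I_ne_zero, h, hω]
    have h1 : ∀ s : ℝ, phase ω m s = Complex.exp (-(Complex.I * m * ω) * s) := fun s => by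
      rw [phase, neg_mul]
    simp only [h1]
    rw [integral_exp_mul_complex hc]
    have h2 : -(Complex.I * m * ω) * ((2 * Real.pi / ω : ℝ) : ℂ) =
        ((-m : ℤ) : ℂ) * (2 * Real.pi * Complex.I) := by
      push_cast
      field_simp
    rw [h2, Complex.exp_int_mul_two_pi_mul_I]
    simp

/-- The coefficients of an absolutely convergent Fourier series are determined by its sum. -/
theorem eq_of_tsum_phase_smul_eq {ω : ℝ} (hω : ω ≠ 0) (ha : Summable fun m => ‖a m‖)
    (hb : Summable fun m => ‖b m‖)
    (h : ∀ s, ∑' m, phase ω m s • a m = ∑' m, phase ω m s • b m) : a = b := by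
  set T : ℝ := 2 * Real.pi / ω with hT
  have hT0 : (T : ℂ) ≠ 0 := by
    have : Real.pi ≠ 0 := Real.pi_ne_zero
    simp [hT, hω, this]
  -- Integrating against `e^{inωs}` over one period isolates the `n`-th coefficient; absolute
  -- summability dominates the interchange of sum and integral.
  have key : ∀ (c : ℤ → F), (Summable fun m => ‖c m‖) → ∀ n,
      ∫ s in (0 : ℝ)..T, phase ω (-n) s • ∑' m, phase ω m s • c m = (T : ℂ) • c n := by
    intro c hc n
    have hs : HasSum (fun m => ∫ s in (0 : ℝ)..T, phase ω (m - n) s • c m)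
        (∫ s in (0 : ℝ)..T, phase ω (-n) s • ∑' m, phase ω m s • c m) := by
      refine intervalIntegral.hasSum_integral_of_dominated_convergence (fun m _ => ‖c m‖)
        (fun m => ?_) (fun m => ?_) ?_ ?_ ?_
      · exact ((continuous_phase ω (m - n)).smul continuous_const).aestronglyMeasurable
      · exact Filter.Eventually.of_forall fun s _ => (norm_phase_smul ω (m - n) s (c m)).le
      · exact Filter.Eventually.of_forall fun s _ => hc
      · exact intervalIntegrable_const
      · refine Filter.Eventually.of_forall fun s _ => ?_
        have := (summable_phase_smul ω s hc).hasSum.const_smul (phase ω (-n) s)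
        refine this.congr_fun fun m => ?_
        rw [smul_smul, ← phase_add_left, sub_eq_add_neg, add_comm]
    rw [← hs.tsum_eq, tsum_eq_single n]
    · rw [intervalIntegral.integral_smul_const, integral_phase hω, if_pos (sub_self n)]
    · intro m hm
      rw [intervalIntegral.integral_smul_const, integral_phase hω, if_neg (sub_ne_zero.2 hm),
        zero_smul]
  funext n
  refine smul_right_injective F hT0 ?_
  change (T : ℂ) • a n = (T : ℂ) • b n
  rw [← key a ha, ← key b hb]
  simp only [h]

end BanachSpace

theorem fourierHam_eq_tsum (ω : ℝ) (h : ℤ → 𝓗 →L[ℂ] 𝓗) (s : ℝ) :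
    fourierHam ω h s = ∑' m, phase ω m s • h m := rfl

variable [CompleteSpace 𝓗] {h : ℤ → 𝓗 →L[ℂ] 𝓗} {ω : ℝ}

theorem isRegularHam_fourierHam (hs : Summable fun m => ‖h m‖)
    (hsa : ∀ s, IsSelfAdjoint (fourierHam ω h s)) : IsRegularHam (fourierHam ω h) where
  continuous := continuous_tsum_phase_smul ω hs
  bounded := ⟨_, norm_tsum_phase_smul_le ω hs⟩
  selfAdjoint := hsa

theorem star_fourierHam (ω : ℝ) (h : ℤ → 𝓗 →L[ℂ] 𝓗) (s : ℝ) :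
    star (fourierHam ω h s) = fourierHam ω (fun m => star (h (-m))) s := by
  rw [fourierHam_eq_tsum, fourierHam_eq_tsum, tsum_star, ← (Equiv.neg ℤ).tsum_eq]
  refine tsum_congr fun m => ?_
  rw [star_smul]
  congr 1
  change (starRingEnd ℂ) (phase ω (-m) s) = _
  rw [conj_phase]
  simp [phase]

/-- Uniqueness of Fourier coefficients turns self-adjointness at every time into this reflection
symmetry, which is what makes `addHam h` self-adjoint. -/
theorem star_coeff_neg (hω : ω ≠ 0) (hs : Summable fun m => ‖h m‖)
    (hsa : ∀ s, IsSelfAdjoint (fourierHam ω h s)) (m : ℤ) : star (h (-m)) = h m := by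
  have hs' : Summable fun m => ‖star (h (-m))‖ := by
    simp only [norm_star]
    exact (Equiv.neg ℤ).summable_iff (f := fun m => ‖h m‖) |>.2 hs
  have h1 : (fun m => star (h (-m))) = h :=
    eq_of_tsum_phase_smul_eq hω hs' hs fun s => (star_fourierHam ω h s).symm.trans (hsa s)
  exact congrFun h1 m

end FourierSeries

/-! ### Block Toeplitz operators and the Floquet Hamiltonian -/

section FloquetHamiltonian

variable {𝓗 : Type*} [NormedAddCommGroup 𝓗] [InnerProductSpace ℂ 𝓗]

@[simp]
theorem addTensor_apply (m : ℤ) (A : 𝓗 →L[ℂ] 𝓗) (ψ : FloquetSpace 𝓗) (l : ℤ) :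
    addTensor m A ψ l = A (ψ (l - m)) := rfl

theorem norm_addTensor_le (m : ℤ) (A : 𝓗 →L[ℂ] 𝓗) : ‖addTensor m A‖ ≤ ‖A‖ :=
  LinearMap.mkContinuous_norm_le _ (norm_nonneg A) _

theorem summable_norm_addTensor {h : ℤ → 𝓗 →L[ℂ] 𝓗} (hs : Summable fun m => ‖h m‖) :
    Summable fun m => ‖addTensor m (h m)‖ :=
  Summable.of_nonneg_of_le (fun m => norm_nonneg (addTensor m (h m)))
    (fun m => norm_addTensor_le m (h m)) hs

theorem addTensor_mul (m n : ℤ) (A B : 𝓗 →L[ℂ] 𝓗) :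
    addTensor m A * addTensor n B = addTensor (n + m) (A * B) := by
  ext ψ l
  simp [sub_sub, add_comm]

/-- The phases at sites `l` and `l - m` leave only their ratio, which does not depend on `l`. -/
theorem phaseOp_mul_addTensor (ω s : ℝ) (m : ℤ) (A : 𝓗 →L[ℂ] 𝓗) :
    phaseOp 𝓗 ω s * addTensor m A * phaseOp 𝓗 ω (-s) = phase ω m s • addTensor m A := by
  ext ψ l
  simp only [mul_apply_eq_comp, phaseOp_apply, addTensor_apply, map_smul, smul_smul,
    smul_apply, lp.coeFn_smul, Pi.smul_apply]
  congr 1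
  rw [show phase ω l s = phase ω m s * phase ω (l - m) s by rw [← phase_add_left, add_sub_cancel],
    mul_assoc, ← phase_add_right, add_neg_cancel, phase_zero_right, mul_one]

/-- The lift `∑_m e^{-imωs} Add_m ⊗ H_m` of a time-periodic Hamiltonian to the Floquet space. -/
def liftHam (ω : ℝ) (h : ℤ → 𝓗 →L[ℂ] 𝓗) : ℝ → FloquetSpace 𝓗 →L[ℂ] FloquetSpace 𝓗 :=
  fourierHam ω fun m => addTensor m (h m)

variable {h : ℤ → 𝓗 →L[ℂ] 𝓗} {ω : ℝ}

theorem liftHam_zero : liftHam ω h 0 = addHam h := by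
  simp [liftHam, fourierHam_eq_tsum, addHam]

theorem mem_graph_floquetHam {ψ φ : FloquetSpace 𝓗} :
    (ψ, φ) ∈ (floquetHam ω h).graph ↔ (ψ, addHam h ψ - φ) ∈ (linPot 𝓗 ω).graph := by
  rw [LinearPMap.mem_graph_iff, LinearPMap.mem_graph_iff]
  constructor
  · rintro ⟨⟨x, hx⟩, rfl, rfl⟩
    refine ⟨⟨x, hx.2⟩, rfl, ?_⟩
    simp [floquetHam, LinearPMap.sub_apply]
  · rintro ⟨⟨x, hx⟩, rfl, h2⟩
    refine ⟨⟨x, trivial, hx⟩, rfl, ?_⟩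
    simp only at h2
    simp [floquetHam, LinearPMap.sub_apply, h2]

theorem floquetHam_domain (ω : ℝ) (h : ℤ → 𝓗 →L[ℂ] 𝓗) :
    (floquetHam ω h).domain = (linPot 𝓗 ω).domain := by
  rw [floquetHam, LinearPMap.sub_domain]
  exact top_inf_eq _

theorem dense_floquetHam_domain (ω : ℝ) (h : ℤ → 𝓗 →L[ℂ] 𝓗) :
    Dense ((floquetHam ω h).domain : Set (FloquetSpace 𝓗)) := by
  rw [floquetHam_domain]
  exact dense_linPot_domain ω

variable [CompleteSpace 𝓗]

theorem hasSum_addHam (hs : Summable fun m => ‖h m‖) :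
    HasSum (fun m => addTensor m (h m)) (addHam h) :=
  have h1 : Summable fun m => addTensor m (h m) := (summable_norm_addTensor hs).of_norm
  h1.hasSum

theorem hasSum_addHam_apply (hs : Summable fun m => ‖h m‖) (ψ : FloquetSpace 𝓗) (l : ℤ) :
    HasSum (fun m => h m (ψ (l - m))) (addHam h ψ l) :=
  (hasSum_addHam hs).mapL
    (lp.evalCLM ℂ (fun _ : ℤ => 𝓗) 2 l ∘L ContinuousLinearMap.apply ℂ (FloquetSpace 𝓗) ψ)

/-- Column zero of a block Toeplitz operator lists its coefficients. -/
theorem block_addHam (hs : Summable fun m => ‖h m‖) (l : ℤ) : block (addHam h) l 0 = h l := by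
  ext x
  have h1 := hasSum_addHam_apply hs (lp.single 2 0 x) l
  refine h1.unique ?_
  have h2 := hasSum_single (f := fun m => h m ((lp.single 2 0 x : FloquetSpace 𝓗) (l - m))) l
    fun m hm => by
      have : (lp.single 2 0 x : FloquetSpace 𝓗) (l - m) = 0 :=
        lp.single_apply_ne (E := fun _ : ℤ => 𝓗) 2 0 x (sub_ne_zero.2 hm.symm)
      rw [this, map_zero]
  simpa using h2

theorem phaseOp_mul_addHam (hs : Summable fun m => ‖h m‖) (ω s : ℝ) :
    phaseOp 𝓗 ω s * addHam h * phaseOp 𝓗 ω (-s) = liftHam ω h s := by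
  rw [liftHam, fourierHam_eq_tsum]
  refine (HasSum.tsum_eq ?_).symm
  have := ((hasSum_addHam hs).mul_left (phaseOp 𝓗 ω s)).mul_right (phaseOp 𝓗 ω (-s))
  simpa only [phaseOp_mul_addTensor] using this

theorem phaseOp_mul_liftHam (hs : Summable fun m => ‖h m‖) (ω s r : ℝ) :
    phaseOp 𝓗 ω r * liftHam ω h s * phaseOp 𝓗 ω (-r) = liftHam ω h (s + r) := by
  rw [← phaseOp_mul_addHam hs, ← phaseOp_mul_addHam hs, add_comm s r, phaseOp_add, neg_add_rev,
    phaseOp_add]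
  simp only [mul_assoc]

theorem star_addTensor (m : ℤ) (A : 𝓗 →L[ℂ] 𝓗) :
    star (addTensor m A) = addTensor (-m) (star A) := by
  rw [ContinuousLinearMap.star_eq_adjoint, eq_comm, ContinuousLinearMap.eq_adjoint_iff]
  intro ψ φ
  rw [lp.inner_eq_tsum, lp.inner_eq_tsum,
    ← (Equiv.subRight m).tsum_eq fun l => inner ℂ ((addTensor (-m) (star A)) ψ l) (φ l)]
  refine tsum_congr fun l => ?_
  simp [ContinuousLinearMap.star_eq_adjoint, ContinuousLinearMap.adjoint_inner_left]

theorem star_addHam (h : ℤ → 𝓗 →L[ℂ] 𝓗) :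
    star (addHam h) = addHam fun m => star (h (-m)) := by
  rw [addHam, addHam, tsum_star, ← (Equiv.neg ℤ).tsum_eq]
  refine tsum_congr fun m => ?_
  simp [star_addTensor]

theorem isRegularHam_liftHam (hω : ω ≠ 0) (hs : Summable fun m => ‖h m‖)
    (hsa : ∀ s, IsSelfAdjoint (fourierHam ω h s)) : IsRegularHam (liftHam ω h) := by
  refine isRegularHam_fourierHam (summable_norm_addTensor hs) fun s => ?_
  -- Self-adjointness is needed only at time zero, since the lift at time `s` is a unitary conjugate
  -- of `addHam h`.
  have h1 : IsSelfAdjoint (addHam h) := by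
    rw [isSelfAdjoint_iff, star_addHam]
    simp only [star_coeff_neg hω hs hsa]
  have h2 := h1.conjugate (phaseOp 𝓗 ω s)
  rwa [star_phaseOp, phaseOp_mul_addHam hs] at h2

theorem phaseOp_mul_timeEvol (hω : ω ≠ 0) (hs : Summable fun m => ‖h m‖)
    (hsa : ∀ s, IsSelfAdjoint (fourierHam ω h s)) (r s s₀ : ℝ) :
    phaseOp 𝓗 ω r * timeEvol (liftHam ω h) s s₀ * phaseOp 𝓗 ω (-r) =
      timeEvol (liftHam ω h) (s + r) (s₀ + r) :=
  (isUnitaryGroup_phaseOp ω).mul_timeEvol_mul (isRegularHam_liftHam hω hs hsa)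
    (fun r s => phaseOp_mul_liftHam hs ω s r) r s s₀

theorem isUnitaryGroup_floquetHam (hω : ω ≠ 0) (hs : Summable fun m => ‖h m‖)
    (hsa : ∀ s, IsSelfAdjoint (fourierHam ω h s)) :
    IsUnitaryGroup (floquetHam ω h) fun s => phaseOp 𝓗 ω (-s) * timeEvol (liftHam ω h) s 0 := by
  have h1 : ∀ x y, (x, y) ∈ (floquetHam ω h).graph ↔
      (x, liftHam ω h 0 x - y) ∈ (linPot 𝓗 ω).graph := fun x y => by
    rw [liftHam_zero]
    exact mem_graph_floquetHam
  have h2 := isRegularHam_liftHam hω hs hsa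
  have h3 : ∀ r s, phaseOp 𝓗 ω r * liftHam ω h s * phaseOp 𝓗 ω (-r) = liftHam ω h (s + r) :=
    fun r s => phaseOp_mul_liftHam hs ω s r
  exact (isUnitaryGroup_phaseOp ω).neg_mul_timeEvol h2 h3 h1

theorem expNegI_floquetHam (hω : ω ≠ 0) (hs : Summable fun m => ‖h m‖)
    (hsa : ∀ s, IsSelfAdjoint (fourierHam ω h s)) (s : ℝ) :
    expNegI (floquetHam ω h) s = phaseOp 𝓗 ω (-s) * timeEvol (liftHam ω h) s 0 :=
  (isUnitaryGroup_floquetHam hω hs hsa).expNegI_eq (dense_floquetHam_domain ω h) s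

theorem expNegI_linPot (ω s : ℝ) : expNegI (linPot 𝓗 ω) s = phaseOp 𝓗 ω s := by
  have h1 := isUnitaryGroup_phaseOp (𝓗 := 𝓗) ω
  have h2 := dense_linPot_domain (𝓗 := 𝓗) ω
  exact h1.expNegI_eq h2 s

end FloquetHamiltonian

/-! ### Absolutely summable symbols of block Toeplitz operators -/

section Symbols

section Intertwining

variable {F G : Type*} [NormedAddCommGroup F] [NormedSpace ℂ F] [CompleteSpace F]
  [NormedAddCommGroup G] [InnerProductSpace ℂ G] [CompleteSpace G] {M : ℤ → F →L[ℂ] F}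
  {h : ℤ → G →L[ℂ] G}

/-- The sum `∑_m e^{-imωs} M_m` of operators on a Banach space. -/
def phaseSum (ω : ℝ) (M : ℤ → F →L[ℂ] F) (s : ℝ) : F →L[ℂ] F := ∑' m, phase ω m s • M m

theorem map_phaseSum (hM : Summable fun m => ‖M m‖) (hs : Summable fun m => ‖h m‖)
    (Φ : F →L[ℂ] (G →L[ℂ] G)) (hΦ : ∀ m x, Φ (M m x) = h m * Φ x) (ω s : ℝ) (x : F) :
    Φ (phaseSum ω M s x) = fourierHam ω h s * Φ x := by
  have h1 := ((summable_phase_smul ω s hM).hasSum.mapL (ContinuousLinearMap.apply ℂ F x)).mapL Φ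
  simp only [ContinuousLinearMap.apply_apply, map_smul, hΦ] at h1
  have h2 := (summable_phase_smul ω s hs).hasSum.mul_right (Φ x)
  simp only [smul_mul_assoc] at h2
  exact h1.unique h2

/-- The solution of `X' = -i ∑_m e^{-imωs} M_m X`, `X(t₀) = x₀`. -/
def phaseEvol (ω : ℝ) (M : ℤ → F →L[ℂ] F) (t₀ : ℝ) (x₀ : F) (t : ℝ) : F :=
  picardSum (fun s => -(Complex.I • phaseSum ω M s)) t₀ x₀ t

/-- The image under `Φ` solves the Schrödinger equation in the target, so uniqueness identifies it.
Solving once in `ℓ¹(ℤ; B(𝓗))` and applying both `toeplitz` and `symbolSum` shows that the lifted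
evolution has summable coefficients, which convergence in operator norm would not give. -/
theorem map_phaseEvol (hM : Summable fun m => ‖M m‖) (hs : Summable fun m => ‖h m‖)
    {ω : ℝ} (hH : IsRegularHam (fourierHam ω h)) (Φ : F →L[ℂ] (G →L[ℂ] G))
    (hΦ : ∀ m x, Φ (M m x) = h m * Φ x) {x₀ : F} (h₀ : Φ x₀ = 1) (t₀ t : ℝ) :
    Φ (phaseEvol ω M t₀ x₀ t) = timeEvol (fourierHam ω h) t t₀ := by
  have hc : Continuous fun s => -(Complex.I • phaseSum ω M s) :=
    ((continuous_tsum_phase_smul ω hM).const_smul Complex.I).neg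
  have hb : ∀ s, ‖-(Complex.I • phaseSum ω M s)‖ ≤ ∑' m, ‖M m‖ := fun s => by
    rw [norm_neg, norm_smul, Complex.norm_I, one_mul]
    exact norm_tsum_phase_smul_le ω hM s
  have hX : ∀ t, HasDerivAt (fun t => Φ (phaseEvol ω M t₀ x₀ t))
      (-(Complex.I • (fourierHam ω h t * Φ (phaseEvol ω M t₀ x₀ t)))) t := fun t => by
    have := (Φ.restrictScalars ℝ).hasFDerivAt.comp_hasDerivAt t (hasDerivAt_picardSum hc hb t₀ x₀ t)
    refine this.congr_deriv ?_
    rw [← map_phaseSum hM hs Φ hΦ, ← map_smul, ← map_neg]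
    rfl
  have h1 := hH.eq_timeEvol_mul hX t t₀
  rwa [show phaseEvol ω M t₀ x₀ t₀ = x₀ from picardSum_self t₀ x₀, h₀, mul_one] at h1

end Intertwining

variable (𝓗 : Type*) [NormedAddCommGroup 𝓗] [InnerProductSpace ℂ 𝓗]

/-- The space `ℓ¹(ℤ; B(𝓗))` of absolutely summable coefficient sequences. -/
abbrev CoeffSpace : Type _ := lp (fun _ : ℤ => 𝓗 →L[ℂ] 𝓗) 1

variable {𝓗}

theorem summable_norm_coeff (a : CoeffSpace 𝓗) : Summable fun m => ‖a m‖ := by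
  simpa using (lp.memℓp a).summable (by norm_num)

theorem norm_eq_tsum_coeff (a : CoeffSpace 𝓗) : ‖a‖ = ∑' m, ‖a m‖ := by
  simpa using lp.norm_rpow_eq_tsum (p := 1) (by norm_num) a

/-- An absolutely summable sequence as an element of `ℓ¹(ℤ; B(𝓗))`. -/
def coeffOf {h : ℤ → 𝓗 →L[ℂ] 𝓗} (hs : Summable fun m => ‖h m‖) : CoeffSpace 𝓗 :=
  ⟨h, memℓp_gen (by simpa using hs)⟩

theorem summable_norm_shift (m : ℤ) (b : CoeffSpace 𝓗) : Summable fun l => ‖b (l - m)‖ :=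
  (Equiv.subRight m).summable_iff (f := fun l => ‖b l‖) |>.2 (summable_norm_coeff b)

theorem summable_norm_mul_shift (m : ℤ) (A : 𝓗 →L[ℂ] 𝓗) (b : CoeffSpace 𝓗) :
    Summable fun l => ‖A * b (l - m)‖ :=
  Summable.of_nonneg_of_le (fun l => norm_nonneg (A * b (l - m)))
    (fun l => norm_mul_le A (b (l - m))) ((summable_norm_shift m b).mul_left ‖A‖)

theorem norm_coeffOf_mul_shift_le (m : ℤ) (A : 𝓗 →L[ℂ] 𝓗) (b : CoeffSpace 𝓗) :
    ‖coeffOf (summable_norm_mul_shift m A b)‖ ≤ ‖A‖ * ‖b‖ := by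
  rw [norm_eq_tsum_coeff, norm_eq_tsum_coeff b,
    ← (Equiv.subRight m).tsum_eq fun l => ‖b l‖, ← tsum_mul_left]
  exact (summable_norm_mul_shift m A b).tsum_le_tsum (fun l => norm_mul_le A (b (l - m)))
    ((summable_norm_shift m b).mul_left ‖A‖)

/-- The operator `(b_l)_l ↦ (A b_{l-m})_l` on `ℓ¹(ℤ; B(𝓗))`. -/
def shiftMul (m : ℤ) (A : 𝓗 →L[ℂ] 𝓗) : CoeffSpace 𝓗 →L[ℂ] CoeffSpace 𝓗 :=
  LinearMap.mkContinuous
    { toFun := fun b => coeffOf (summable_norm_mul_shift m A b)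
      map_add' := fun b c => by
        ext l : 2
        exact mul_add A (b (l - m)) (c (l - m))
      map_smul' := fun z b => by
        ext l : 2
        exact mul_smul_comm z A (b (l - m)) } ‖A‖
    (norm_coeffOf_mul_shift_le m A)

@[simp]
theorem shiftMul_apply (m : ℤ) (A : 𝓗 →L[ℂ] 𝓗) (b : CoeffSpace 𝓗) (l : ℤ) :
    shiftMul m A b l = A * b (l - m) := rfl

theorem norm_shiftMul_le (m : ℤ) (A : 𝓗 →L[ℂ] 𝓗) : ‖shiftMul m A‖ ≤ ‖A‖ :=
  LinearMap.mkContinuous_norm_le _ (norm_nonneg A) _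

theorem addTensor_add (m : ℤ) (A B : 𝓗 →L[ℂ] 𝓗) :
    addTensor m (A + B) = addTensor m A + addTensor m B := by
  ext ψ l
  simp

theorem addTensor_smul (m : ℤ) (c : ℂ) (A : 𝓗 →L[ℂ] 𝓗) :
    addTensor m (c • A) = c • addTensor m A := by
  ext ψ l
  simp

theorem summable_norm_shiftMul {h : ℤ → 𝓗 →L[ℂ] 𝓗} (hs : Summable fun m => ‖h m‖) :
    Summable fun m => ‖shiftMul m (h m)‖ :=
  Summable.of_nonneg_of_le (fun m => norm_nonneg (shiftMul m (h m)))
    (fun m => norm_shiftMul_le m (h m)) hs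

variable [CompleteSpace 𝓗]

/-- The block Toeplitz operator `∑_m Add_m ⊗ a_m` as a linear function of its coefficients. -/
def toeplitz : CoeffSpace 𝓗 →L[ℂ] (FloquetSpace 𝓗 →L[ℂ] FloquetSpace 𝓗) :=
  LinearMap.mkContinuous
    { toFun := fun a => addHam a
      map_add' := fun a b => by
        have := (hasSum_addHam (summable_norm_coeff a)).add (hasSum_addHam (summable_norm_coeff b))
        simp only [← addTensor_add] at this
        exact (hasSum_addHam (summable_norm_coeff (a + b))).unique this
      map_smul' := fun c a => by
        have := (hasSum_addHam (summable_norm_coeff a)).const_smul c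
        simp only [← addTensor_smul] at this
        exact (hasSum_addHam (summable_norm_coeff (c • a))).unique this } 1
    fun a => by
      have h1 := summable_norm_addTensor (summable_norm_coeff a)
      rw [one_mul, norm_eq_tsum_coeff]
      exact (norm_tsum_le_tsum_norm h1).trans
        (h1.tsum_le_tsum (fun m => norm_addTensor_le m (a m)) (summable_norm_coeff a))

theorem toeplitz_apply (a : CoeffSpace 𝓗) : toeplitz a = addHam a := rfl

/-- The value `∑_m a_m` of the symbol at phase zero. -/
def symbolSum : CoeffSpace 𝓗 →L[ℂ] (𝓗 →L[ℂ] 𝓗) := lp.tsumCLM ℂ ℤ (𝓗 →L[ℂ] 𝓗)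

theorem symbolSum_apply (a : CoeffSpace 𝓗) : symbolSum a = ∑' m, a m := rfl

theorem toeplitz_shiftMul (m : ℤ) (A : 𝓗 →L[ℂ] 𝓗) (b : CoeffSpace 𝓗) :
    toeplitz (shiftMul m A b) = addTensor m A * toeplitz b := by
  have h1 := (hasSum_addHam (summable_norm_coeff b)).mul_left (addTensor m A)
  have h2 := (Equiv.addRight m).hasSum_iff.2 (hasSum_addHam (summable_norm_coeff (shiftMul m A b)))
  refine h2.unique (h1.congr_fun fun l => ?_)
  simp [addTensor_mul]

theorem symbolSum_shiftMul (m : ℤ) (A : 𝓗 →L[ℂ] 𝓗) (b : CoeffSpace 𝓗) :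
    symbolSum (shiftMul m A b) = A * symbolSum b := by
  rw [symbolSum_apply, symbolSum_apply,
    ← (Summable.of_norm (summable_norm_coeff b)).tsum_mul_left A,
    ← (Equiv.subRight m).tsum_eq fun l => A * b l]
  rfl

theorem toeplitz_single_one : toeplitz (lp.single 1 0 1 : CoeffSpace 𝓗) = 1 := by
  have h1 := hasSum_addHam (summable_norm_coeff (lp.single 1 0 1 : CoeffSpace 𝓗))
  refine h1.unique ?_
  have h2 := hasSum_single (f := fun m => addTensor m ((lp.single 1 0 1 : CoeffSpace 𝓗) m)) 0
    fun m hm => by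
      have : (lp.single 1 0 1 : CoeffSpace 𝓗) m = 0 :=
        lp.single_apply_ne (E := fun _ : ℤ => 𝓗 →L[ℂ] 𝓗) 1 0 1 hm
      rw [this]
      ext ψ l
      simp
  have h3 : addTensor 0 ((lp.single 1 0 1 : CoeffSpace 𝓗) 0) = 1 := by
    ext ψ l
    simp
  rwa [h3] at h2

theorem symbolSum_single_one : symbolSum (lp.single 1 0 1 : CoeffSpace 𝓗) = 1 := by
  rw [symbolSum_apply, tsum_eq_single 0]
  · simp
  · intro m hm
    exact lp.single_apply_ne (E := fun _ : ℤ => 𝓗 →L[ℂ] 𝓗) 1 0 1 hm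

variable {h : ℤ → 𝓗 →L[ℂ] 𝓗} {ω : ℝ}

/-- `X` is a block Toeplitz operator with absolutely summable coefficients whose sum is `x`. -/
def HasSymbol (X : FloquetSpace 𝓗 →L[ℂ] FloquetSpace 𝓗) (x : 𝓗 →L[ℂ] 𝓗) : Prop :=
  ∃ a : CoeffSpace 𝓗, toeplitz a = X ∧ symbolSum a = x

theorem toeplitz_phaseSum (hs : Summable fun m => ‖h m‖) (ω s : ℝ) (b : CoeffSpace 𝓗) :
    toeplitz (phaseSum ω (fun m => shiftMul m (h m)) s b) = liftHam ω h s * toeplitz b :=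
  map_phaseSum (F := CoeffSpace 𝓗) (G := FloquetSpace 𝓗) (M := fun m => shiftMul m (h m))
    (h := fun m => addTensor m (h m)) (summable_norm_shiftMul hs) (summable_norm_addTensor hs)
    toeplitz (fun m b => toeplitz_shiftMul m (h m) b) ω s b

theorem symbolSum_phaseSum (hs : Summable fun m => ‖h m‖) (ω s : ℝ) (b : CoeffSpace 𝓗) :
    symbolSum (phaseSum ω (fun m => shiftMul m (h m)) s b) = fourierHam ω h s * symbolSum b :=
  map_phaseSum (F := CoeffSpace 𝓗) (G := 𝓗) (M := fun m => shiftMul m (h m))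
    (h := h) (summable_norm_shiftMul hs) hs
    symbolSum (fun m b => symbolSum_shiftMul m (h m) b) ω s b

theorem toeplitz_phaseEvol (hω : ω ≠ 0) (hs : Summable fun m => ‖h m‖)
    (hsa : ∀ s, IsSelfAdjoint (fourierHam ω h s)) (t t₀ : ℝ) :
    toeplitz (phaseEvol ω (fun m => shiftMul m (h m)) t₀ (lp.single 1 0 1) t) =
      timeEvol (liftHam ω h) t t₀ :=
  map_phaseEvol (F := CoeffSpace 𝓗) (G := FloquetSpace 𝓗) (M := fun m => shiftMul m (h m))
    (h := fun m => addTensor m (h m)) (summable_norm_shiftMul hs) (summable_norm_addTensor hs)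
    (isRegularHam_liftHam hω hs hsa) toeplitz (fun m b => toeplitz_shiftMul m (h m) b)
    toeplitz_single_one t₀ t

theorem symbolSum_phaseEvol (hs : Summable fun m => ‖h m‖)
    (hsa : ∀ s, IsSelfAdjoint (fourierHam ω h s)) (t t₀ : ℝ) :
    symbolSum (phaseEvol ω (fun m => shiftMul m (h m)) t₀ (lp.single 1 0 1) t) =
      timeEvol (fourierHam ω h) t t₀ :=
  map_phaseEvol (F := CoeffSpace 𝓗) (G := 𝓗) (M := fun m => shiftMul m (h m))
    (h := h) (summable_norm_shiftMul hs) hs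
    (isRegularHam_fourierHam hs hsa) symbolSum (fun m b => symbolSum_shiftMul m (h m) b)
    symbolSum_single_one t₀ t

namespace HasSymbol

variable {X Y : FloquetSpace 𝓗 →L[ℂ] FloquetSpace 𝓗} {x y : 𝓗 →L[ℂ] 𝓗}

theorem one : HasSymbol (1 : FloquetSpace 𝓗 →L[ℂ] FloquetSpace 𝓗) 1 :=
  ⟨_, toeplitz_single_one, symbolSum_single_one⟩

theorem add (hX : HasSymbol X x) (hY : HasSymbol Y y) : HasSymbol (X + Y) (x + y) := by
  obtain ⟨a, rfl, rfl⟩ := hX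
  obtain ⟨b, rfl, rfl⟩ := hY
  exact ⟨a + b, map_add _ _ _, map_add _ _ _⟩

theorem sub (hX : HasSymbol X x) (hY : HasSymbol Y y) : HasSymbol (X - Y) (x - y) := by
  obtain ⟨a, rfl, rfl⟩ := hX
  obtain ⟨b, rfl, rfl⟩ := hY
  exact ⟨a - b, map_sub _ _ _, map_sub _ _ _⟩

theorem smul (c : ℂ) (hX : HasSymbol X x) : HasSymbol (c • X) (c • x) := by
  obtain ⟨a, rfl, rfl⟩ := hX
  exact ⟨c • a, map_smul _ _ _, map_smul _ _ _⟩

theorem sum {ι : Type*} (s : Finset ι) {X : ι → FloquetSpace 𝓗 →L[ℂ] FloquetSpace 𝓗}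
    {x : ι → 𝓗 →L[ℂ] 𝓗} (hX : ∀ i ∈ s, HasSymbol (X i) (x i)) :
    HasSymbol (∑ i ∈ s, X i) (∑ i ∈ s, x i) := by
  classical
  induction s using Finset.induction_on with
  | empty => exact ⟨0, by simp, by simp⟩
  | insert i s hi ih =>
    rw [Finset.sum_insert hi, Finset.sum_insert hi]
    exact (hX i (Finset.mem_insert_self i s)).add
      (ih fun j hj => hX j (Finset.mem_insert_of_mem hj))

theorem liftHam (hs : Summable fun m => ‖h m‖) (ω s : ℝ) :
    HasSymbol (liftHam ω h s) (fourierHam ω h s) := by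
  refine ⟨phaseSum ω (fun m => shiftMul m (h m)) s (lp.single 1 0 1), ?_, ?_⟩
  · rw [toeplitz_phaseSum hs, toeplitz_single_one, mul_one]
  · rw [symbolSum_phaseSum hs, symbolSum_single_one, mul_one]

theorem mul (hX : HasSymbol X x) (hY : HasSymbol Y y) : HasSymbol (X * Y) (x * y) := by
  obtain ⟨a, rfl, rfl⟩ := hX
  obtain ⟨b, rfl, rfl⟩ := hY
  have hs := summable_norm_coeff a
  -- With frequency and time zero every phase is `1`, so this is the convolution of `a` with `b`.
  refine ⟨phaseSum 0 (fun m => shiftMul m (a m)) 0 b, ?_, ?_⟩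
  · rw [toeplitz_phaseSum hs, liftHam_zero, ← toeplitz_apply]
  · rw [symbolSum_phaseSum hs]
    congr 1
    simp [fourierHam_eq_tsum, symbolSum_apply]

theorem star (hX : HasSymbol X x) : HasSymbol (star X) (star x) := by
  obtain ⟨a, rfl, rfl⟩ := hX
  have hs : Summable fun m => ‖Star.star (a (-m))‖ := by
    simp only [norm_star]
    exact (Equiv.neg ℤ).summable_iff (f := fun m => ‖a m‖) |>.2 (summable_norm_coeff a)
  refine ⟨coeffOf hs, ?_, ?_⟩
  · rw [toeplitz_apply, toeplitz_apply, star_addHam]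
    rfl
  · rw [symbolSum_apply, symbolSum_apply, tsum_star]
    exact (Equiv.neg ℤ).tsum_eq fun m => Star.star (a m)

theorem timeEvol (hω : ω ≠ 0) (hs : Summable fun m => ‖h m‖)
    (hsa : ∀ s, IsSelfAdjoint (fourierHam ω h s)) (t t₀ : ℝ) :
    HasSymbol (timeEvol (FloquetPF.liftHam ω h) t t₀) (timeEvol (fourierHam ω h) t t₀) :=
  ⟨_, toeplitz_phaseEvol hω hs hsa t t₀, symbolSum_phaseEvol hs hsa t t₀⟩

theorem summable_norm_block (hX : HasSymbol X x) : Summable fun l => ‖block X l 0‖ := by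
  obtain ⟨a, rfl, rfl⟩ := hX
  have hs := summable_norm_coeff a
  simpa only [toeplitz_apply, block_addHam hs] using hs

/-- The symbol value is read off from column zero, so it depends on `X` only and not on the chosen
coefficients. -/
theorem tsum_block (hX : HasSymbol X x) : ∑' l, block X l 0 = x := by
  obtain ⟨a, rfl, rfl⟩ := hX
  simp only [toeplitz_apply, block_addHam (summable_norm_coeff a), symbolSum_apply]

end HasSymbol

end Symbols

/-! ### The product formula and its defect -/

theorem mul_mem_Icc_zero {t τ c : ℝ} (hτ : τ ∈ Set.Icc 0 t) (hc : c ∈ Set.Icc (0 : ℝ) 1) :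
    c * τ ∈ Set.Icc 0 t :=
  ⟨mul_nonneg hc.1 hτ.1, (mul_le_of_le_one_left hτ.1 hc.2).trans hτ.2⟩

section ProductFormula

variable {𝓗 : Type*} [NormedAddCommGroup 𝓗] [InnerProductSpace ℂ 𝓗] [CompleteSpace 𝓗]
  {Γ : ℕ} {H : Fin Γ → ℝ → 𝓗 →L[ℂ] 𝓗} {γ : ℕ → Fin Γ} {α β : ℕ → ℝ}

/-- The operator `Q_n` with `S_n' = -i S_n Q_n`, for the product `S_n` of the first `n` factors. -/
def formulaRate (H : Fin Γ → ℝ → 𝓗 →L[ℂ] 𝓗) (γ : ℕ → Fin Γ) (α β : ℕ → ℝ) (τ : ℝ) (n : ℕ) :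
    𝓗 →L[ℂ] 𝓗 :=
  ∑ k ∈ Finset.Icc 1 n, ((β k + α k : ℝ) : ℂ) • (star (partialFormula H γ α β τ k) *
      H (γ k) ((β k + α k) * τ) * partialFormula H γ α β τ k)
    - ∑ k ∈ Finset.Icc 1 n, ((β k : ℝ) : ℂ) • (star (partialFormula H γ α β τ (k - 1)) *
      H (γ k) (β k * τ) * partialFormula H γ α β τ (k - 1))

/-- The defect `S† H S - i S† S'` of the product formula. -/
def formulaDelta (H : Fin Γ → ℝ → 𝓗 →L[ℂ] 𝓗) (K : ℕ) (γ : ℕ → Fin Γ) (α β : ℕ → ℝ) (τ : ℝ) :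
    𝓗 →L[ℂ] 𝓗 :=
  ∑ j, star (partialFormula H γ α β τ K) * H j τ * partialFormula H γ α β τ K
    - formulaRate H γ α β τ K

/-- The adjoint reverses time, so both signs of `α k` are covered by one expression. -/
theorem formulaFactor_eq (hH : ∀ j, IsRegularHam (H j)) (τ : ℝ) (k : ℕ) :
    formulaFactor H γ α β τ k = timeEvol (H (γ k)) ((β k + α k) * τ) (β k * τ) := by
  rw [formulaFactor]
  split_ifs with h
  · rw [add_mul]
  · rw [← ContinuousLinearMap.star_eq_adjoint, (hH _).star_timeEvol, abs_of_neg (not_le.1 h)]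
    congr 1
    ring

theorem partialFormula_mem_unitary (hH : ∀ j, IsRegularHam (H j)) (τ : ℝ) (n : ℕ) :
    partialFormula H γ α β τ n ∈ unitary (𝓗 →L[ℂ] 𝓗) := by
  induction n with
  | zero => exact one_mem _
  | succ n ih =>
    rw [partialFormula, formulaFactor_eq hH]
    exact mul_mem ((hH _).timeEvol_mem_unitary _ _) ih

theorem hasDerivAt_partialFormula (hH : ∀ j, IsRegularHam (H j)) (n : ℕ) (τ : ℝ) :
    HasDerivAt (fun τ => partialFormula H γ α β τ n)
      (-(Complex.I • (partialFormula H γ α β τ n * formulaRate H γ α β τ n))) τ := by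
  induction n with
  | zero =>
    simp only [partialFormula, formulaRate]
    exact (hasDerivAt_const τ _).congr_deriv (by simp)
  | succ n ih =>
    have h1 := ((hH (γ (n + 1))).hasDerivAt_timeEvol_mul
      (β (n + 1) + α (n + 1)) (β (n + 1)) τ).mul ih
    have hS : ∀ τ, partialFormula H γ α β τ (n + 1) = timeEvol (H (γ (n + 1)))
        ((β (n + 1) + α (n + 1)) * τ) (β (n + 1) * τ) * partialFormula H γ α β τ n := fun τ => by
      rw [partialFormula, formulaFactor_eq hH]
    have hrate : formulaRate H γ α β τ (n + 1) = formulaRate H γ α β τ n +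
        (((β (n + 1) + α (n + 1) : ℝ) : ℂ) • (star (partialFormula H γ α β τ (n + 1)) *
          H (γ (n + 1)) ((β (n + 1) + α (n + 1)) * τ) * partialFormula H γ α β τ (n + 1)) -
        ((β (n + 1) : ℝ) : ℂ) • (star (partialFormula H γ α β τ n) *
          H (γ (n + 1)) (β (n + 1) * τ) * partialFormula H γ α β τ n)) := by
      simp only [formulaRate, Finset.sum_Icc_succ_top (Nat.le_add_left 1 n), Nat.add_sub_cancel]
      abel
    -- The derivative of the new factor puts Hamiltonians on either side of it; inserting `P P† = 1`
    -- for the partial products moves both terms to the far right.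
    have u1 := Unitary.mul_star_self_of_mem
      (partialFormula_mem_unitary (γ := γ) (α := α) (β := β) hH τ (n + 1))
    have u2 := Unitary.mul_star_self_of_mem
      (partialFormula_mem_unitary (γ := γ) (α := α) (β := β) hH τ n)
    have e1 : partialFormula H γ α β τ (n + 1) * (star (partialFormula H γ α β τ (n + 1)) *
        H (γ (n + 1)) ((β (n + 1) + α (n + 1)) * τ) * partialFormula H γ α β τ (n + 1)) =
        H (γ (n + 1)) ((β (n + 1) + α (n + 1)) * τ) * partialFormula H γ α β τ (n + 1) := by
      rw [mul_assoc (star _), ← mul_assoc, u1, one_mul]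
    have e2 : partialFormula H γ α β τ n * (star (partialFormula H γ α β τ n) *
        H (γ (n + 1)) (β (n + 1) * τ) * partialFormula H γ α β τ n) =
        H (γ (n + 1)) (β (n + 1) * τ) * partialFormula H γ α β τ n := by
      rw [mul_assoc (star _), ← mul_assoc, u2, one_mul]
    rw [hrate, mul_add, mul_sub, mul_smul_comm, e1, mul_smul_comm, hS τ,
      mul_assoc _ _ (star _ * _ * _), e2]
    refine (h1.congr_of_eventuallyEq (Filter.Eventually.of_forall hS)).congr_deriv ?_
    simp only [neg_mul, mul_neg, smul_mul_assoc, mul_smul_comm, sub_mul, smul_add, smul_sub,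
      mul_assoc]
    abel

theorem continuous_partialFormula (hH : ∀ j, IsRegularHam (H j)) (n : ℕ) :
    Continuous fun τ => partialFormula H γ α β τ n :=
  continuous_iff_continuousAt.2 fun τ => (hasDerivAt_partialFormula hH n τ).continuousAt

theorem continuous_formulaDelta (hH : ∀ j, IsRegularHam (H j)) (K : ℕ) :
    Continuous fun τ => formulaDelta H K γ α β τ := by
  have hS := fun n => continuous_partialFormula (γ := γ) (α := α) (β := β) hH n
  have hc : ∀ n j (c : ℝ), Continuous fun τ => star (partialFormula H γ α β τ n) *
      H j (c * τ) * partialFormula H γ α β τ n := fun n j c =>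
    ((hS n).star.mul ((hH j).continuous.comp (continuous_const.mul continuous_id))).mul (hS n)
  refine Continuous.sub ?_ (Continuous.sub ?_ ?_)
  · exact continuous_finsetSum _ fun j _ => ((hS K).star.mul (hH j).continuous).mul (hS K)
  · exact continuous_finsetSum _ fun k _ => (hc k (γ k) (β k + α k)).fun_const_smul _
  · exact continuous_finsetSum _ fun k _ => (hc (k - 1) (γ k) (β k)).fun_const_smul _

theorem isRegularHam_sum (hH : ∀ j, IsRegularHam (H j)) : IsRegularHam fun s => ∑ j, H j s where
  continuous := continuous_finsetSum _ fun j _ => (hH j).continuous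
  bounded := by
    choose C hC using fun j => (hH j).bounded
    exact ⟨∑ j, C j, fun s => norm_sum_le_of_le _ fun j _ => hC j s⟩
  selfAdjoint s := by
    rw [isSelfAdjoint_iff, star_sum]
    exact Finset.sum_congr rfl fun j _ => ((hH j).selfAdjoint s).star_eq

theorem partialFormula_apply_zero (hH : ∀ j, IsRegularHam (H j)) (n : ℕ) :
    partialFormula H γ α β 0 n = 1 := by
  induction n with
  | zero => rfl
  | succ n ih =>
    rw [partialFormula, formulaFactor_eq hH, ih, mul_zero, mul_zero, timeEvol_self, one_mul]

theorem hasDerivAt_timeEvol_mul_partialFormula (hH : ∀ j, IsRegularHam (H j)) (K : ℕ) (t τ : ℝ) :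
    HasDerivAt (fun τ => timeEvol (fun s => ∑ j, H j s) t τ * partialFormula H γ α β τ K)
      (Complex.I • (timeEvol (fun s => ∑ j, H j s) t τ * partialFormula H γ α β τ K *
        formulaDelta H K γ α β τ)) τ := by
  refine (((isRegularHam_sum hH).hasDerivAt_timeEvol_right t τ).mul
    (hasDerivAt_partialFormula hH K τ)).congr_deriv ?_
  have u := Unitary.mul_star_self_of_mem
    (partialFormula_mem_unitary (γ := γ) (α := α) (β := β) hH τ K)
  -- By unitarity, `S` times the defect is `H S - S Q`, exactly what the product rule produces up to
  -- `i U`.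
  have e : partialFormula H γ α β τ K * formulaDelta H K γ α β τ =
      (∑ j, H j τ) * partialFormula H γ α β τ K -
        partialFormula H γ α β τ K * formulaRate H γ α β τ K := by
    rw [formulaDelta, mul_sub, Finset.mul_sum, Finset.sum_mul]
    congr 1
    refine Finset.sum_congr rfl fun j _ => ?_
    rw [mul_assoc (star _), ← mul_assoc, u, one_mul]
  rw [mul_assoc (timeEvol _ _ _) (partialFormula _ _ _ _ _ _), e]
  simp only [mul_neg, smul_mul_assoc, mul_smul_comm, mul_sub, smul_sub, mul_assoc]
  abel

theorem integral_timeEvol_mul_formulaDelta (hH : ∀ j, IsRegularHam (H j)) (K : ℕ) (t : ℝ) :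
    timeEvol (fun s => ∑ j, H j s) t 0 - partialFormula H γ α β t K =
      -(Complex.I • ∫ τ in (0 : ℝ)..t, timeEvol (fun s => ∑ j, H j s) t τ *
        partialFormula H γ α β τ K * formulaDelta H K γ α β τ) := by
  have hc : Continuous fun τ => timeEvol (fun s => ∑ j, H j s) t τ * partialFormula H γ α β τ K :=
    continuous_iff_continuousAt.2 fun τ =>
      (hasDerivAt_timeEvol_mul_partialFormula hH K t τ).continuousAt
  have h1 := intervalIntegral.integral_eq_sub_of_hasDerivAt (a := 0) (b := t)
    (fun τ _ => hasDerivAt_timeEvol_mul_partialFormula (γ := γ) (α := α) (β := β) hH K t τ)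
    (((hc.mul (continuous_formulaDelta hH K)).const_smul Complex.I).intervalIntegrable 0 t)
  rw [intervalIntegral.integral_smul, timeEvol_self, partialFormula_apply_zero hH, one_mul,
    mul_one] at h1
  rw [h1, neg_sub]

/-- The endpoints `β k * τ` and `(β k + α k) * τ` of every factor stay in `[0,t]`, so values of the
Hamiltonians elsewhere are irrelevant. -/
theorem partialFormula_congr {K : ℕ} (hF : IsFormula K γ α β) {G : Fin Γ → ℝ → 𝓗 →L[ℂ] 𝓗} {t : ℝ}
    (hHG : ∀ j, ∀ τ ∈ Set.Icc 0 t, H j τ = G j τ) {τ : ℝ} (hτ : τ ∈ Set.Icc 0 t) {n : ℕ}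
    (hn : n ≤ K) : partialFormula H γ α β τ n = partialFormula G γ α β τ n := by
  induction n with
  | zero => rfl
  | succ n ih =>
    have hk : n + 1 ∈ Finset.Icc 1 K := Finset.mem_Icc.2 ⟨Nat.le_add_left 1 n, hn⟩
    have h1 := mul_mem_Icc_zero hτ (hF.beta_mem _ hk)
    have h2 := mul_mem_Icc_zero hτ (hF.beta_add_alpha_mem _ hk)
    rw [partialFormula, partialFormula, ih (Nat.le_of_succ_le hn)]
    congr 1
    rw [formulaFactor, formulaFactor]
    split_ifs with h
    · rw [add_mul] at h2
      exact timeEvol_congr Set.ordConnected_Icc (hHG _) h2 h1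
    · have h3 : β (n + 1) * τ - |α (n + 1)| * τ = (β (n + 1) + α (n + 1)) * τ := by
        rw [abs_of_neg (not_le.1 h)]
        ring
      rw [h3, timeEvol_congr Set.ordConnected_Icc (hHG _) h1 h2]

end ProductFormula

/-! ### The Floquet-space product formula -/

section FloquetFormula

variable {𝓗 : Type*} [NormedAddCommGroup 𝓗] [InnerProductSpace ℂ 𝓗] [CompleteSpace 𝓗]
  {Γ : ℕ} {h : Fin Γ → ℤ → 𝓗 →L[ℂ] 𝓗} {γ : ℕ → Fin Γ} {α β : ℕ → ℝ} {ω : ℝ}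

theorem floquetFactor_odd (hω : ω ≠ 0) (hs : ∀ j, Summable fun m => ‖h j m‖)
    (hsa : ∀ j, ∀ s, IsSelfAdjoint (fourierHam ω (h j) s)) (τ : ℝ) (n : ℕ) :
    floquetFactor ω h γ α β τ (2 * n + 1) = phaseOp 𝓗 ω (-(α (n + 1) * τ)) *
      timeEvol (liftHam ω (h (γ (n + 1)))) (α (n + 1) * τ) 0 := by
  have h1 : (2 * n + 1 + 1) / 2 = n + 1 := by omega
  rw [floquetFactor, if_pos (odd_two_mul_add_one n), h1, expNegI_floquetHam hω (hs _) (hsa _)]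

theorem floquetFactor_even (τ : ℝ) (n : ℕ) :
    floquetFactor ω h γ α β τ (2 * n + 1 + 1) =
      phaseOp 𝓗 ω ((β (n + 1) + α (n + 1) - β (n + 2)) * τ) := by
  have h1 : (2 * n + 1 + 1) / 2 = n + 1 := by omega
  have h2 : ¬ Odd (2 * n + 1 + 1) := by
    rw [Nat.not_odd_iff_even]
    exact ⟨n + 1, by ring⟩
  rw [floquetFactor, if_neg h2, h1, expNegI_linPot]

/-- After each pair of factors of the Floquet-space formula the shifts of the time origin
telescope. -/
theorem floquetPartial_odd_of_even (hω : ω ≠ 0) (hs : ∀ j, Summable fun m => ‖h j m‖)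
    (hsa : ∀ j, ∀ s, IsSelfAdjoint (fourierHam ω (h j) s)) (τ : ℝ) (n : ℕ)
    (hn : floquetPartial ω h γ α β τ (2 * n) = phaseOp 𝓗 ω (-(β (n + 1) * τ)) *
      partialFormula (fun j => liftHam ω (h j)) γ α β τ n) :
    floquetPartial ω h γ α β τ (2 * n + 1) = phaseOp 𝓗 ω (-((β (n + 1) + α (n + 1)) * τ)) *
      partialFormula (fun j => liftHam ω (h j)) γ α β τ (n + 1) := by
  have hreg : ∀ j, IsRegularHam (liftHam ω (h j)) := fun j => isRegularHam_liftHam hω (hs j) (hsa j)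
  -- The phase left by the preceding factors translates the evolution from `[0, ατ]` to start at
  -- `βτ`, the interval used by the product formula.
  have h1 := phaseOp_mul_timeEvol hω (hs (γ (n + 1))) (hsa (γ (n + 1))) (β (n + 1) * τ)
    (α (n + 1) * τ) 0
  rw [zero_add, ← add_mul, add_comm (α (n + 1))] at h1
  have h2 : phaseOp 𝓗 ω (-((β (n + 1) + α (n + 1)) * τ)) =
      phaseOp 𝓗 ω (-(α (n + 1) * τ)) * phaseOp 𝓗 ω (-(β (n + 1) * τ)) := by
    rw [← phaseOp_add]
    congr 1
    ring
  rw [floquetPartial, hn, floquetFactor_odd hω hs hsa, partialFormula, formulaFactor_eq hreg, ← h1,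
    h2]
  simp only [mul_assoc]
  rw [← mul_assoc (phaseOp 𝓗 ω (-(β (n + 1) * τ))) (phaseOp 𝓗 ω (β (n + 1) * τ)),
    phaseOp_neg_mul_phaseOp, one_mul]

/-- The `H_LP` factor replaces the accumulated shift `β_k + α_k` by `β_{k+1}`, the starting point of
the next factor. The condition `β 1 = 0` starts the telescoping with no phase. -/
theorem floquetPartial_even (hω : ω ≠ 0) (hs : ∀ j, Summable fun m => ‖h j m‖)
    (hsa : ∀ j, ∀ s, IsSelfAdjoint (fourierHam ω (h j) s)) (hβ : β 1 = 0) (τ : ℝ) (n : ℕ) :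
    floquetPartial ω h γ α β τ (2 * n) = phaseOp 𝓗 ω (-(β (n + 1) * τ)) *
      partialFormula (fun j => liftHam ω (h j)) γ α β τ n := by
  induction n with
  | zero => simp [floquetPartial, partialFormula, hβ, phaseOp_zero]
  | succ n ih =>
    rw [show 2 * (n + 1) = 2 * n + 1 + 1 by ring, floquetPartial,
      floquetPartial_odd_of_even hω hs hsa τ n ih, floquetFactor_even, ← mul_assoc, ← phaseOp_add]
    congr 2
    ring

theorem floquetPartial_odd (hω : ω ≠ 0) (hs : ∀ j, Summable fun m => ‖h j m‖)
    (hsa : ∀ j, ∀ s, IsSelfAdjoint (fourierHam ω (h j) s)) (hβ : β 1 = 0) (τ : ℝ) (n : ℕ) :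
    floquetPartial ω h γ α β τ (2 * n + 1) = phaseOp 𝓗 ω (-((β (n + 1) + α (n + 1)) * τ)) *
      partialFormula (fun j => liftHam ω (h j)) γ α β τ (n + 1) :=
  floquetPartial_odd_of_even hω hs hsa τ n (floquetPartial_even hω hs hsa hβ τ n)

theorem conjBy_phaseOp_mul {a : ℤ → 𝓗 →L[ℂ] 𝓗} (hs : Summable fun m => ‖a m‖) (s : ℝ)
    (P : FloquetSpace 𝓗 →L[ℂ] FloquetSpace 𝓗) :
    conjBy (phaseOp 𝓗 ω (-s) * P) (addHam a) = star P * liftHam ω a s * P := by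
  rw [conjBy, ← ContinuousLinearMap.star_eq_adjoint, star_mul, star_phaseOp, neg_neg,
    ← phaseOp_mul_addHam hs]
  simp only [mul_assoc]

theorem floquetDelta_eq {K : ℕ} (hF : IsFormula K γ α β) (hω : ω ≠ 0)
    (hs : ∀ j, Summable fun m => ‖h j m‖)
    (hsa : ∀ j, ∀ s, IsSelfAdjoint (fourierHam ω (h j) s)) (τ : ℝ) :
    floquetDelta ω h K γ α β τ = formulaDelta (fun j => liftHam ω (h j)) K γ α β τ := by
  have hodd : ∀ k ∈ Finset.Icc 1 K, floquetPartial ω h γ α β τ (2 * k - 1) =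
      phaseOp 𝓗 ω (-((β k + α k) * τ)) *
        partialFormula (fun j => liftHam ω (h j)) γ α β τ k := fun k hk => by
    -- With `k = n + 1` the truncated subtraction `2 * k - 1` reduces to `2 * n + 1`.
    obtain ⟨n, rfl⟩ := Nat.exists_eq_add_of_le' (Finset.mem_Icc.1 hk).1
    exact floquetPartial_odd hω hs hsa hF.beta_one τ n
  have heven : ∀ k ∈ Finset.Icc 1 K, floquetPartial ω h γ α β τ (2 * k - 2) =
      phaseOp 𝓗 ω (-(β k * τ)) *
        partialFormula (fun j => liftHam ω (h j)) γ α β τ (k - 1) := fun k hk => by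
    obtain ⟨n, rfl⟩ := Nat.exists_eq_add_of_le' (Finset.mem_Icc.1 hk).1
    exact floquetPartial_even hω hs hsa hF.beta_one τ n
  -- Since `β K + α K = 1`, the final phase moves each `H^Add_j` to time `τ` exactly.
  have h1 : floquetFormula ω h K γ α β τ = phaseOp 𝓗 ω (-τ) *
      partialFormula (fun j => liftHam ω (h j)) γ α β τ K := by
    rw [floquetFormula, hodd K (Finset.mem_Icc.2 ⟨hF.one_le, le_rfl⟩), hF.beta_last, one_mul]
  rw [floquetDelta, formulaDelta, formulaRate, ← sub_add]
  congr 1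
  · congr 1
    · exact Finset.sum_congr rfl fun j _ => by rw [h1, conjBy_phaseOp_mul (hs j)]
    · exact Finset.sum_congr rfl fun k hk => by rw [hodd k hk, conjBy_phaseOp_mul (hs (γ k))]
  · exact Finset.sum_congr rfl fun k hk => by rw [heven k hk, conjBy_phaseOp_mul (hs (γ k))]

theorem hasSymbol_partialFormula (hω : ω ≠ 0) (hs : ∀ j, Summable fun m => ‖h j m‖)
    (hsa : ∀ j, ∀ s, IsSelfAdjoint (fourierHam ω (h j) s)) (τ : ℝ) (n : ℕ) :
    HasSymbol (partialFormula (fun j => liftHam ω (h j)) γ α β τ n)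
      (partialFormula (fun j => fourierHam ω (h j)) γ α β τ n) := by
  induction n with
  | zero => exact HasSymbol.one
  | succ n ih =>
    rw [partialFormula, partialFormula,
      formulaFactor_eq fun j => isRegularHam_liftHam hω (hs j) (hsa j),
      formulaFactor_eq fun j => isRegularHam_fourierHam (hs j) (hsa j)]
    exact (HasSymbol.timeEvol hω (hs _) (hsa _) _ _).mul ih

/-- The defect is built from evolutions, lifts, adjoints, products and linear combinations, all
compatible with taking symbols. -/
theorem hasSymbol_formulaDelta (hω : ω ≠ 0) (hs : ∀ j, Summable fun m => ‖h j m‖)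
    (hsa : ∀ j, ∀ s, IsSelfAdjoint (fourierHam ω (h j) s)) (K : ℕ) (τ : ℝ) :
    HasSymbol (formulaDelta (fun j => liftHam ω (h j)) K γ α β τ)
      (formulaDelta (fun j => fourierHam ω (h j)) K γ α β τ) := by
  have hS := hasSymbol_partialFormula (γ := γ) (α := α) (β := β) hω hs hsa τ
  have hc : ∀ n j s, HasSymbol
      (star (partialFormula (fun j => liftHam ω (h j)) γ α β τ n) * liftHam ω (h j) s *
        partialFormula (fun j => liftHam ω (h j)) γ α β τ n)
      (star (partialFormula (fun j => fourierHam ω (h j)) γ α β τ n) * fourierHam ω (h j) s *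
        partialFormula (fun j => fourierHam ω (h j)) γ α β τ n) := fun n j s =>
    ((hS n).star.mul (HasSymbol.liftHam (hs j) ω s)).mul (hS n)
  exact (HasSymbol.sum _ fun j _ => hc K j τ).sub
    ((HasSymbol.sum _ fun k _ => (hc k (γ k) _).smul _).sub
      (HasSymbol.sum _ fun k _ => (hc (k - 1) (γ k) _).smul _))

end FloquetFormula

end

end FloquetPF

theorem mainTheorem5 {𝓗 : Type*} [NormedAddCommGroup 𝓗] [InnerProductSpace ℂ 𝓗] [CompleteSpace 𝓗]
    {Γ K : ℕ} (γ : ℕ → Fin Γ) (α β : ℕ → ℝ) (hformula : FloquetPF.IsFormula K γ α β)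
    (t ω : ℝ) (ht : 0 ≤ t) (hω : 0 < ω)
    (h : Fin Γ → ℤ → 𝓗 →L[ℂ] 𝓗)
    (hsummable : ∀ j, Summable fun m : ℤ => ‖h j m‖)
    (hselfAdjoint : ∀ j, ∀ τ : ℝ, IsSelfAdjoint (FloquetPF.fourierHam ω (h j) τ))
    (H : Fin Γ → ℝ → 𝓗 →L[ℂ] 𝓗)
    (hH : ∀ j, ∀ τ ∈ Set.Icc 0 t, H j τ = FloquetPF.fourierHam ω (h j) τ) :
    (∀ τ ∈ Set.Icc 0 t,
      Summable fun l : ℤ => ‖FloquetPF.block (FloquetPF.floquetDelta ω h K γ α β τ) l 0‖) ∧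
    IntervalIntegrable (fun τ => FloquetPF.timeEvol (fun s => ∑ j, H j s) t τ *
      FloquetPF.productFormula H K γ α β τ * FloquetPF.deltaSum ω h K γ α β τ)
      MeasureTheory.volume 0 t ∧
    FloquetPF.timeEvol (fun s => ∑ j, H j s) t 0 - FloquetPF.productFormula H K γ α β t =
      -(Complex.I • ∫ τ in (0 : ℝ)..t, FloquetPF.timeEvol (fun s => ∑ j, H j s) t τ *
        FloquetPF.productFormula H K γ α β τ * FloquetPF.deltaSum ω h K γ α β τ) ∧
    IntervalIntegrable (fun τ => ‖FloquetPF.deltaSum ω h K γ α β τ‖)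
      MeasureTheory.volume 0 t ∧
    ‖FloquetPF.timeEvol (fun s => ∑ j, H j s) t 0 - FloquetPF.productFormula H K γ α β t‖ ≤
      ∫ τ in (0 : ℝ)..t, ‖FloquetPF.deltaSum ω h K γ α β τ‖ := by
  open FloquetPF in
  have hG : ∀ j, IsRegularHam (fourierHam ω (h j)) := fun j =>
    isRegularHam_fourierHam (hsummable j) (hselfAdjoint j)
  have hsym : ∀ τ, HasSymbol (floquetDelta ω h K γ α β τ)
      (formulaDelta (fun j => fourierHam ω (h j)) K γ α β τ) := fun τ => by
    rw [floquetDelta_eq hformula hω.ne' hsummable hselfAdjoint]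
    exact hasSymbol_formulaDelta hω.ne' hsummable hselfAdjoint K τ
  -- Only the Fourier data enter here, so the equality holds for every real `τ` and gives continuity
  -- on the whole line.
  have hD : deltaSum ω h K γ α β = formulaDelta (fun j => fourierHam ω (h j)) K γ α β :=
    funext fun τ => (hsym τ).tsum_block
  have hDc : Continuous (deltaSum ω h K γ α β) := hD ▸ continuous_formulaDelta hG K
  have hU : ∀ τ ∈ Set.Icc 0 t, timeEvol (fun s => ∑ j, H j s) t τ =
      timeEvol (fun s => ∑ j, fourierHam ω (h j) s) t τ := fun τ hτ =>
    timeEvol_congr Set.ordConnected_Icc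
      (fun s hs => Finset.sum_congr rfl fun j _ => hH j s hs) ⟨ht, le_rfl⟩ hτ
  have hS : ∀ τ ∈ Set.Icc 0 t, productFormula H K γ α β τ =
      partialFormula (fun j => fourierHam ω (h j)) γ α β τ K := fun τ hτ =>
    partialFormula_congr hformula hH hτ le_rfl
  have hUS : Continuous fun τ => timeEvol (fun s => ∑ j, fourierHam ω (h j) s) t τ *
      partialFormula (fun j => fourierHam ω (h j)) γ α β τ K :=
    continuous_iff_continuousAt.2 fun τ =>
      (hasDerivAt_timeEvol_mul_partialFormula hG K t τ).continuousAt
  have hcongr : Set.EqOn (fun τ => timeEvol (fun s => ∑ j, H j s) t τ *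
      productFormula H K γ α β τ * deltaSum ω h K γ α β τ)
      (fun τ => timeEvol (fun s => ∑ j, fourierHam ω (h j) s) t τ *
        partialFormula (fun j => fourierHam ω (h j)) γ α β τ K * deltaSum ω h K γ α β τ)
      (Set.uIcc 0 t) := fun τ hτ => by
    rw [Set.uIcc_of_le ht] at hτ
    simp only [hU τ hτ, hS τ hτ]
  -- On `[0,t]` both `U(t,τ)` and `S(τ,0)` coincide with those of the periodic Hamiltonians, hence
  -- are unitary and drop out of the norm.
  have hnorm : ∀ τ ∈ Set.Icc 0 t, ‖timeEvol (fun s => ∑ j, H j s) t τ *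
      productFormula H K γ α β τ * deltaSum ω h K γ α β τ‖ = ‖deltaSum ω h K γ α β τ‖ :=
    fun τ hτ => by
      rw [hU τ hτ, hS τ hτ]
      exact CStarRing.norm_mem_unitary_mul _
        (mul_mem ((isRegularHam_sum hG).timeEvol_mem_unitary t τ)
          (partialFormula_mem_unitary hG τ K))
  have hmain : timeEvol (fun s => ∑ j, H j s) t 0 - productFormula H K γ α β t =
      -(Complex.I • ∫ τ in (0 : ℝ)..t, timeEvol (fun s => ∑ j, H j s) t τ *
        productFormula H K γ α β τ * deltaSum ω h K γ α β τ) := by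
    rw [intervalIntegral.integral_congr hcongr, hU 0 ⟨le_rfl, ht⟩, hS t ⟨ht, le_rfl⟩,
      integral_timeEvol_mul_formulaDelta hG, hD]
  refine ⟨fun τ _ => (hsym τ).summable_norm_block, ?_, hmain, hDc.norm.intervalIntegrable 0 t, ?_⟩
  · exact ((hUS.mul hDc).continuousOn.congr hcongr).intervalIntegrable
  · rw [hmain, norm_neg, norm_smul, Complex.norm_I, one_mul]
    refine intervalIntegral.norm_integral_le_of_norm_le ht
      (Filter.Eventually.of_forall fun τ hτ => (hnorm τ ⟨hτ.1.le, hτ.2⟩).le)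
      (hDc.norm.intervalIntegrable 0 t)
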